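/- Let $p(y_1,y_2\mid x_1,x_2)$ be a discrete memoryless interference channel with finite alphabets, and let $(U_{1,i},V_{1,i})_{i\ge1}$ and $(U_{2,i},V_{2,i})_{i\ge1}$ be two mutually independent i.i.d. sequences of source/side-information pairs, with finite alphabets and per-letter laws $p(u_1,v_1)$ and $p(u_2,v_2)$. For block length $n$, transmitter $k$ maps $U_k^n$ to a channel input block $X_k^n=f_k^n(U_k^n)$, and receiver $k$ forms $\hat U_k^n=g_k^n(Y_k^n,V_k^n)$ from its channel output and its side information, $k=1,2$. The sources can be transmitted reliably if there are encoders and decoders $(f_1^n,f_2^n,g_1^n,g_2^n)$, $n\ge 0$, with $\Pr\{(\hat U_1^n,\hat U_2^n)\ne(U_1^n,U_2^n)\}\to0$. Let $\mathcal C\subset\mathbb R^2$ be the capacity region of the channel, i.e. the closure of the set of pairs $(R_1,R_2)$ with $R_1,R_2\ge0$ for which there are channel codes with $\lceil 2^{nR_1}\rceil$ and $\lceil 2^{nR_2}\rceil$ messages and block length $n$ whose probability that at least one receiver decodes its message incorrectly, for independent uniformly distributed messages, tends to $0$ as $n\to\infty$. Entropies are in bits. If $(H(U_1|V_1),H(U_2|V_2))$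 lies in the interior of $\mathcal C$, then the sources can be transmitted reliably. Moreover this can be done by separate coding: there are rates $R_1,R_2\ge0$, Slepian–Wolf codes for $U_k^n$ with decoder side information $V_k^n$ and $\lceil 2^{nR_k}\rceil$ indices ($k=1,2$), and channel codes with $\lceil 2^{nR_1}\rceil$ and $\lceil 2^{nR_2}\rceil$ messages, such that the error probabilities of the two Slepian–Wolf codes, of the channel code, and of their concatenation all tend to $0$. Conversely, if $(H(U_1|V_1),H(U_2|V_2))\notin\mathcal C$, then the sources cannot be transmitted reliably. -/

import Mathlib

open Filter Topology

namespace InterferenceChannel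

/-- Probability that a memoryless source with per-letter joint mass function `p`
emits the source block `u` together with the side-information block `v`. -/
noncomputable def sourceProb {U V : Type*} (p : U × V → ℝ) {n : ℕ}
    (u : Fin n → U) (v : Fin n → V) : ℝ :=
  ∏ i, p (u i, v i)

/-- Probability that `n` uses of the memoryless channel `W = p(y₁, y₂ | x₁, x₂)` with input
blocks `x₁`, `x₂` produce the output blocks `y₁`, `y₂`. -/
noncomputable def channelProb {X₁ X₂ Y₁ Y₂ : Type*} (W : X₁ → X₂ → Y₁ × Y₂ → ℝ) {n : ℕ}
    (x₁ : Fin n → X₁) (x₂ : Fin n → X₂) (y₁ : Fin n → Y₁) (y₂ : Fin n → Y₂) : ℝ :=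
  ∏ i, W (x₁ i) (x₂ i) (y₁ i, y₂ i)

/-- The conditional entropy `H(U|V)` in bits of a pair with joint mass function `p`:
`-∑ p(u,v) log₂ p(u|v)`, where `p(u|v) = p(u,v) / p(v)`.
Terms with `p(u,v) = 0` vanish, as usual. -/
noncomputable def condEntropy {U V : Type*} [Fintype U] [Fintype V] (p : U × V → ℝ) : ℝ :=
  -∑ u, ∑ v, p (u, v) * Real.logb 2 (p (u, v) / ∑ u', p (u', v))

/-! ### Channel coding and the capacity region -/

/-- A code of block length `n` for the interference channel, with `M₁` messages for user 1 and
`M₂` messages for user 2. -/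
structure ChannelCode (X₁ X₂ Y₁ Y₂ : Type*) (n M₁ M₂ : ℕ) where
  enc₁ : Fin M₁ → (Fin n → X₁)
  enc₂ : Fin M₂ → (Fin n → X₂)
  dec₁ : (Fin n → Y₁) → Fin M₁
  dec₂ : (Fin n → Y₂) → Fin M₂

open Classical in
/-- Probability that `(Ŵ₁, Ŵ₂) ≠ (W₁, W₂)`, for independent uniform messages `W₁`, `W₂`. -/
noncomputable def ChannelCode.errorProb {X₁ X₂ Y₁ Y₂ : Type*} [Fintype Y₁] [Fintype Y₂]
    {n M₁ M₂ : ℕ} (c : ChannelCode X₁ X₂ Y₁ Y₂ n M₁ M₂) (W : X₁ → X₂ → Y₁ × Y₂ → ℝ) : ℝ :=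
  ((M₁ : ℝ) * (M₂ : ℝ))⁻¹ *
    ∑ w₁ : Fin M₁, ∑ w₂ : Fin M₂, ∑ y₁ : Fin n → Y₁, ∑ y₂ : Fin n → Y₂,
      if (c.dec₁ y₁, c.dec₂ y₂) ≠ (w₁, w₂) then
        channelProb W (c.enc₁ w₁) (c.enc₂ w₂) y₁ y₂ else 0

/-- The number `⌈2 ^ (n R)⌉` of messages of a rate-`R` code (in bits) of block length `n`. -/
noncomputable def numMessages (n : ℕ) (R : ℝ) : ℕ := ⌈(2 : ℝ) ^ ((n : ℝ) * R)⌉₊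

/-- A pair of non-negative rates is achievable if there are codes of these rates, one for each
block length, whose error probability tends to zero. -/
def Achievable {X₁ X₂ Y₁ Y₂ : Type*} [Fintype Y₁] [Fintype Y₂]
    (W : X₁ → X₂ → Y₁ × Y₂ → ℝ) (R : ℝ × ℝ) : Prop :=
  0 ≤ R.1 ∧ 0 ≤ R.2 ∧
    ∃ c : ∀ n, ChannelCode X₁ X₂ Y₁ Y₂ n (numMessages n R.1) (numMessages n R.2),
      Tendsto (fun n => (c n).errorProb W) atTop (𝓝 0)

/-- The capacity region: the closure, in the plane, of the set of achievable rate pairs. -/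
def capacityRegion {X₁ X₂ Y₁ Y₂ : Type*} [Fintype Y₁] [Fintype Y₂]
    (W : X₁ → X₂ → Y₁ × Y₂ → ℝ) : Set (ℝ × ℝ) :=
  closure {R | Achievable W R}

/-! ### Transmission of sources with side information about the desired source -/

/-- A joint source-channel code of block length `n`: transmitter `k` maps its source block to a
channel input block, and receiver `k` maps its channel output block and its side-information
block to an estimate of the source block of transmitter `k`. -/
structure JointCode (U₁ V₁ U₂ V₂ X₁ X₂ Y₁ Y₂ : Type*) (n : ℕ) where
  enc₁ : (Fin n → U₁) → (Fin n → X₁)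
  enc₂ : (Fin n → U₂) → (Fin n → X₂)
  dec₁ : (Fin n → Y₁) → (Fin n → V₁) → (Fin n → U₁)
  dec₂ : (Fin n → Y₂) → (Fin n → V₂) → (Fin n → U₂)

open Classical in
/-- Probability that `(Û₁ⁿ, Û₂ⁿ) ≠ (U₁ⁿ, U₂ⁿ)`. The two source/side-information pairs are
independent, with per-letter mass functions `p₁` and `p₂`. -/
noncomputable def JointCode.errorProb {U₁ V₁ U₂ V₂ X₁ X₂ Y₁ Y₂ : Type*}
    [Fintype U₁] [Fintype V₁] [Fintype U₂] [Fintype V₂] [Fintype Y₁] [Fintype Y₂] {n : ℕ}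
    (c : JointCode U₁ V₁ U₂ V₂ X₁ X₂ Y₁ Y₂ n)
    (p₁ : U₁ × V₁ → ℝ) (p₂ : U₂ × V₂ → ℝ) (W : X₁ → X₂ → Y₁ × Y₂ → ℝ) : ℝ :=
  ∑ u₁ : Fin n → U₁, ∑ v₁ : Fin n → V₁, ∑ u₂ : Fin n → U₂, ∑ v₂ : Fin n → V₂,
    ∑ y₁ : Fin n → Y₁, ∑ y₂ : Fin n → Y₂,
      if (c.dec₁ y₁ v₁, c.dec₂ y₂ v₂) ≠ (u₁, u₂) then
        sourceProb p₁ u₁ v₁ * sourceProb p₂ u₂ v₂ *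
          channelProb W (c.enc₁ u₁) (c.enc₂ u₂) y₁ y₂ else 0

/-- The sources can be reliably transmitted: some sequence of joint source-channel codes has
error probability tending to zero. -/
def ReliablyTransmittable {U₁ V₁ U₂ V₂ X₁ X₂ Y₁ Y₂ : Type*}
    [Fintype U₁] [Fintype V₁] [Fintype U₂] [Fintype V₂] [Fintype Y₁] [Fintype Y₂]
    (p₁ : U₁ × V₁ → ℝ) (p₂ : U₂ × V₂ → ℝ) (W : X₁ → X₂ → Y₁ × Y₂ → ℝ) : Prop :=
  ∃ c : ∀ n, JointCode U₁ V₁ U₂ V₂ X₁ X₂ Y₁ Y₂ n,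
    Tendsto (fun n => (c n).errorProb p₁ p₂ W) atTop (𝓝 0)

/-! ### Separate source and channel coding -/

/-- A Slepian-Wolf source code of block length `n` with `M` indices: the encoder sees only the
source block, the decoder sees the index and the side-information block. -/
structure SlepianWolfCode (U V : Type*) (n M : ℕ) where
  enc : (Fin n → U) → Fin M
  dec : Fin M → (Fin n → V) → (Fin n → U)

open Classical in
/-- Probability that the source block is not recovered from the (error-free) index and the
side information. -/
noncomputable def SlepianWolfCode.errorProb {U V : Type*} [Fintype U] [Fintype V] {n M : ℕ}
    (s : SlepianWolfCode U V n M) (p : U × V → ℝ) : ℝ :=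
  ∑ u : Fin n → U, ∑ v : Fin n → V,
    if s.dec (s.enc u) v ≠ u then sourceProb p u v else 0

/-- The joint code in which each source is first compressed by a Slepian-Wolf code, and the
resulting indices are sent as the messages of a channel code. -/
def JointCode.ofSeparate {U₁ V₁ U₂ V₂ X₁ X₂ Y₁ Y₂ : Type*} {n M₁ M₂ : ℕ}
    (s₁ : SlepianWolfCode U₁ V₁ n M₁) (s₂ : SlepianWolfCode U₂ V₂ n M₂)
    (c : ChannelCode X₁ X₂ Y₁ Y₂ n M₁ M₂) : JointCode U₁ V₁ U₂ V₂ X₁ X₂ Y₁ Y₂ n where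
  enc₁ u₁ := c.enc₁ (s₁.enc u₁)
  enc₂ u₂ := c.enc₂ (s₂.enc u₂)
  dec₁ y₁ v₁ := s₁.dec (c.dec₁ y₁) v₁
  dec₂ y₂ v₂ := s₂.dec (c.dec₂ y₂) v₂

/-- The sources can be reliably transmitted by separate coding: at some rate pair there are
Slepian-Wolf codes and channel codes, each reliable by itself, whose concatenation reliably
transmits the sources. -/
def SeparatelyTransmittable {U₁ V₁ U₂ V₂ X₁ X₂ Y₁ Y₂ : Type*}
    [Fintype U₁] [Fintype V₁] [Fintype U₂] [Fintype V₂] [Fintype Y₁] [Fintype Y₂]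
    (p₁ : U₁ × V₁ → ℝ) (p₂ : U₂ × V₂ → ℝ) (W : X₁ → X₂ → Y₁ × Y₂ → ℝ) : Prop :=
  ∃ R₁ R₂ : ℝ, 0 ≤ R₁ ∧ 0 ≤ R₂ ∧
    ∃ (s₁ : ∀ n, SlepianWolfCode U₁ V₁ n (numMessages n R₁))
      (s₂ : ∀ n, SlepianWolfCode U₂ V₂ n (numMessages n R₂))
      (c : ∀ n, ChannelCode X₁ X₂ Y₁ Y₂ n (numMessages n R₁) (numMessages n R₂)),
      Tendsto (fun n => (s₁ n).errorProb p₁) atTop (𝓝 0) ∧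
      Tendsto (fun n => (s₂ n).errorProb p₂) atTop (𝓝 0) ∧
      Tendsto (fun n => (c n).errorProb W) atTop (𝓝 0) ∧
      Tendsto (fun n => (JointCode.ofSeparate (s₁ n) (s₂ n) (c n)).errorProb p₁ p₂ W)
        atTop (𝓝 0)

end InterferenceChannel

/-! The capacity region is defined operationally, so no single-letter formula and no Fano inequality
is needed: each direction turns one kind of code into another by a random choice.

Converse. A good joint code is turned into channel codes of rates just below `H(U_k|V_k)`. Codewords
are independent source blocks with the law of `U_k^n`, passed through the joint encoder. On average
over the codebooks, the interference has the same law as under the joint code, so receiver `k` sees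
the channel from `U_k^n` to `Y_k^n` with the other user averaged out (`exists_interference_code`).
Since `U_k^n` is recovered from `(Y_k^n, V_k^n)` while its conditional probability given `V_k^n` is
about `2^(-nH)`, the likelihood ratio of the output is rarely below `2^(n(H-2ε))`
(`prob_le_threshold_le`). Threshold decoding therefore works at rate `H-3ε`, and closedness of the
region lets `ε → 0`.

Direct part. An interior point is strictly dominated in both coordinates by an achievable pair,
which leaves room for random binning. The channel code is good only on average over uniform
messages, whereas bin indices need not be uniform. For fixed source blocks, however, random binning
makes the two indices independent and uniform, so averaging over the bins gives exactly the average
error of the channel code. One choice of bins serves all the error probabilities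
(`ChannelCode.exists_slepianWolfCodes`). -/

namespace InterferenceChannel

/-! ### Random functions with independent values -/

/-- The expectation of `F` over a random function `C : I → A` whose values are independent with
mass function `P`. -/
noncomputable def randAvg {I A : Type*} [Fintype I] [DecidableEq I] [Fintype A]
    (P : A → ℝ) (F : (I → A) → ℝ) : ℝ :=
  ∑ C : I → A, (∏ i, P (C i)) * F C

section RandAvg

variable {I A : Type*} [Fintype I] [DecidableEq I] [Fintype A] {P : A → ℝ}

theorem randAvg_mono (hP : ∀ a, 0 ≤ P a) {F G : (I → A) → ℝ} (h : ∀ C, F C ≤ G C) :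
    randAvg P F ≤ randAvg P G :=
  Finset.sum_le_sum fun C _ =>
    mul_le_mul_of_nonneg_left (h C) (Finset.prod_nonneg fun i _ => hP (C i))

theorem randAvg_add (F G : (I → A) → ℝ) :
    randAvg P (fun C => F C + G C) = randAvg P F + randAvg P G := by
  simp only [randAvg, mul_add, Finset.sum_add_distrib]

theorem randAvg_sum {J : Type*} (s : Finset J) (F : J → (I → A) → ℝ) :
    randAvg P (fun C => ∑ j ∈ s, F j C) = ∑ j ∈ s, randAvg P (F j) := by
  simp only [randAvg, Finset.mul_sum]
  exact Finset.sum_comm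

theorem randAvg_const_mul (r : ℝ) (F : (I → A) → ℝ) :
    randAvg P (fun C => r * F C) = r * randAvg P F := by
  simp only [randAvg, Finset.mul_sum]
  exact Finset.sum_congr rfl fun C _ => by ring

theorem randAvg_apply_mul_apply (hP : ∑ a, P a = 1) {i j : I} (hij : i ≠ j) (g h : A → ℝ) :
    randAvg P (fun C => g (C i) * h (C j)) = (∑ a, P a * g a) * ∑ a, P a * h a := by
  -- Padding with factors 1 at the other coordinates makes the integrand a full product, so the sum
  -- over all functions factorizes.
  have key : ∀ C : I → A, (∏ k, P (C k)) * (g (C i) * h (C j)) =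
      ∏ k, P (C k) * ((if k = i then g (C k) else 1) * (if k = j then h (C k) else 1)) := by
    intro C
    simp only [Finset.prod_mul_distrib, Finset.prod_ite_eq', Finset.mem_univ, if_true]
  have key' : ∀ k : I,
      ∑ a, P a * ((if k = i then g a else 1) * (if k = j then h a else 1)) =
      (if k = i then ∑ a, P a * g a else 1) * (if k = j then ∑ a, P a * h a else 1) := by
    intro k
    by_cases hi : k = i
    · have : k ≠ j := fun h => hij (hi.symm.trans h)
      simp [hi, hij]
    · by_cases hj : k = j <;> simp [hj, hi, hP, Ne.symm hij]
  simp only [randAvg, key]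
  rw [← Fintype.piFinset_univ, ← Finset.prod_univ_sum (fun _ => Finset.univ)
    (fun k a => P a * ((if k = i then g a else 1) * (if k = j then h a else 1)))]
  simp only [key', Finset.prod_mul_distrib, Finset.prod_ite_eq', Finset.mem_univ, if_true]

theorem randAvg_apply (hP : ∑ a, P a = 1) (i : I) (g : A → ℝ) :
    randAvg P (fun C => g (C i)) = ∑ a, P a * g a := by
  have key : ∀ C : I → A, (∏ k, P (C k)) * g (C i) =
      ∏ k, P (C k) * (if k = i then g (C k) else 1) := by
    intro C
    simp only [Finset.prod_mul_distrib, Finset.prod_ite_eq', Finset.mem_univ, if_true]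
  have key' : ∀ k : I, ∑ a, P a * (if k = i then g a else 1) =
      if k = i then ∑ a, P a * g a else 1 := by
    intro k
    by_cases hi : k = i <;> simp [hi, hP]
  simp only [randAvg, key]
  rw [← Fintype.piFinset_univ, ← Finset.prod_univ_sum (fun _ => Finset.univ)
    (fun k a => P a * (if k = i then g a else 1))]
  simp only [key', Finset.prod_ite_eq', Finset.mem_univ, if_true]

theorem sum_prod_eq_one (hP : ∑ a, P a = 1) : ∑ C : I → A, ∏ i, P (C i) = 1 := by
  rw [← Fintype.piFinset_univ, ← Finset.prod_univ_sum (fun _ => Finset.univ) (fun _ a => P a)]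
  simp [hP]

theorem randAvg_const (hP : ∑ a, P a = 1) (r : ℝ) :
    randAvg P (fun _ : I → A => r) = r := by
  rw [randAvg, ← Finset.sum_mul, sum_prod_eq_one hP, one_mul]

theorem exists_le_randAvg (hP0 : ∀ a, 0 ≤ P a) (hP : ∑ a, P a = 1) (F : (I → A) → ℝ) :
    ∃ C, F C ≤ randAvg P F := by
  by_contra! hlt
  have hw : ∀ C : I → A, 0 ≤ ∏ i, P (C i) := fun C => Finset.prod_nonneg fun i _ => hP0 (C i)
  have h0 : ∑ C : I → A, (∏ i, P (C i)) * (F C - randAvg P F) = 0 := by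
    simp only [mul_sub, Finset.sum_sub_distrib]
    rw [← Finset.sum_mul, sum_prod_eq_one hP, one_mul]
    exact sub_self _
  rw [Finset.sum_eq_zero_iff_of_nonneg
    fun C _ => mul_nonneg (hw C) (sub_nonneg.2 (hlt C).le)] at h0
  have : ∑ C : I → A, ∏ i, P (C i) = 0 := Finset.sum_eq_zero fun C hC =>
    (mul_eq_zero.1 (h0 C hC)).resolve_right (sub_pos.2 (hlt C)).ne'
  rw [sum_prod_eq_one hP] at this
  exact one_ne_zero this

/-- The probabilistic method for a pair of independent random choices: two codebooks, or two
binnings. -/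
theorem exists_le_randAvg_randAvg {J B : Type*} [Fintype J] [DecidableEq J] [Fintype B]
    {Q : B → ℝ} (hP0 : ∀ a, 0 ≤ P a) (hP : ∑ a, P a = 1) (hQ0 : ∀ b, 0 ≤ Q b)
    (hQ : ∑ b, Q b = 1) (F : (I → A) → (J → B) → ℝ) :
    ∃ C D, F C D ≤ randAvg P fun C => randAvg Q fun D => F C D := by
  obtain ⟨C, hC⟩ := exists_le_randAvg hP0 hP fun C => randAvg Q fun D => F C D
  obtain ⟨D, hD⟩ := exists_le_randAvg hQ0 hQ fun D => F C D
  exact ⟨C, D, hD.trans hC⟩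

end RandAvg

/-! ### Large deviations -/

/-- The exponential moment equals 1 at `t = 0` and its derivative there is the mean minus `a`, which
is negative. -/
theorem exists_sum_exp_lt_one {Z : Type*} [Fintype Z] {p : Z → ℝ} (hp : ∑ z, p z = 1)
    {f : Z → ℝ} {a : ℝ} (ha : ∑ z, p z * f z < a) :
    ∃ t : ℝ, 0 < t ∧ ∑ z, p z * Real.exp (t * (f z - a)) < 1 := by
  have hd : HasDerivAt (fun t : ℝ => ∑ z, p z * Real.exp (t * (f z - a)))
      (∑ z, p z * (f z - a)) 0 := by
    refine HasDerivAt.fun_sum fun z _ => ?_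
    have := (((hasDerivAt_id (0 : ℝ)).mul_const (f z - a)).exp).const_mul (p z)
    simpa using this
  have hneg : ∑ z, p z * (f z - a) < 0 := by
    simp only [mul_sub, Finset.sum_sub_distrib, ← Finset.sum_mul, hp]
    linarith
  have hs := hd.tendsto_slope_zero_right
  have hev := hs.eventually (gt_mem_nhds hneg)
  obtain ⟨t, ht, ht0⟩ := (hev.and self_mem_nhdsWithin).exists
  refine ⟨t, ht0, ?_⟩
  have ht0' : (0 : ℝ) < t := ht0
  simp only [zero_add, zero_mul, Real.exp_zero, mul_one, hp, smul_eq_mul] at ht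
  by_contra! hge
  exact absurd ht (not_lt.2 (mul_nonneg (inv_nonneg.2 ht0'.le) (by linarith)))

-- Chernoff bound: the indicator is at most `exp (t * (∑ f - n a))`, whose mean factorizes into the
-- `n`-th power of a number below 1.
open Classical in
theorem tendsto_sum_deviation {Z : Type*} [Fintype Z] {p : Z → ℝ} (hp0 : ∀ z, 0 ≤ p z)
    (hp : ∑ z, p z = 1) {f : Z → ℝ} {a : ℝ} (ha : ∑ z, p z * f z < a) :
    Tendsto (fun n : ℕ => ∑ z : Fin n → Z,
      if n * a ≤ ∑ i, f (z i) then ∏ i, p (z i) else 0) atTop (𝓝 0) := by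
  obtain ⟨t, ht, hlt⟩ := exists_sum_exp_lt_one hp ha
  set r := ∑ z, p z * Real.exp (t * (f z - a)) with hr
  have hr0 : 0 ≤ r := Finset.sum_nonneg fun z _ => mul_nonneg (hp0 z) (Real.exp_pos _).le
  refine squeeze_zero (fun n => Finset.sum_nonneg fun z _ => ?_) (fun n => ?_)
    (tendsto_pow_atTop_nhds_zero_of_lt_one hr0 hlt)
  · split_ifs
    · exact Finset.prod_nonneg fun i _ => hp0 _
    · exact le_rfl
  · have hpow : r ^ n = ∑ z : Fin n → Z, ∏ i, p (z i) * Real.exp (t * (f (z i) - a)) := by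
      rw [← Fintype.piFinset_univ, ← Finset.prod_univ_sum (fun _ => Finset.univ)
        (fun _ z => p z * Real.exp (t * (f z - a)))]
      simp [hr]
    rw [hpow]
    refine Finset.sum_le_sum fun z _ => ?_
    rw [Finset.prod_mul_distrib, ← Real.exp_sum]
    have h0 : 0 ≤ ∏ i, p (z i) := Finset.prod_nonneg fun i _ => hp0 _
    split_ifs with h
    · refine le_mul_of_one_le_right h0 (Real.one_le_exp ?_)
      rw [← Finset.mul_sum, Finset.sum_sub_distrib]
      simp only [Finset.sum_const, Finset.card_univ, Fintype.card_fin, nsmul_eq_mul]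
      exact mul_nonneg ht.le (sub_nonneg.2 h)
    · exact mul_nonneg h0 (Real.exp_pos _).le

/-! ### Typical source blocks -/

/-- The probability of a side-information block. -/
noncomputable def sideProb {U V : Type*} [Fintype U] (p : U × V → ℝ) {n : ℕ}
    (v : Fin n → V) : ℝ :=
  ∏ i, ∑ u, p (u, v i)

theorem sum_sourceProb_eq_sideProb {U V : Type*} [Fintype U] {p : U × V → ℝ}
    {n : ℕ} (v : Fin n → V) :
    ∑ u : Fin n → U, sourceProb p u v = sideProb p v := by
  simp only [sourceProb, sideProb]
  rw [← Fintype.piFinset_univ, ← Finset.prod_univ_sum (fun _ => Finset.univ)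
    (fun i u => p (u, v i))]

section Source

variable {U V : Type*} [Fintype U] [Fintype V] {p : U × V → ℝ}

theorem sourceProb_nonneg (hp : p ∈ stdSimplex ℝ (U × V)) {n : ℕ} (u : Fin n → U)
    (v : Fin n → V) : 0 ≤ sourceProb p u v :=
  Finset.prod_nonneg fun _ _ => hp.1 _

theorem sum_block_pairs {n : ℕ} (F : (Fin n → U) → (Fin n → V) → ℝ) :
    ∑ z : Fin n → U × V, F (fun i => (z i).1) (fun i => (z i).2) = ∑ u, ∑ v, F u v := by
  rw [← Fintype.sum_prod_type']
  exact Fintype.sum_equiv (Equiv.arrowProdEquivProdArrow (Fin n) (fun _ => U) (fun _ => V)) _ _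
    fun z => rfl

theorem sum_sourceProb (hp : p ∈ stdSimplex ℝ (U × V)) (n : ℕ) :
    ∑ u : Fin n → U, ∑ v : Fin n → V, sourceProb p u v = 1 := by
  rw [← sum_block_pairs]
  exact sum_prod_eq_one hp.2

theorem condEntropy_eq :
    ∑ z : U × V, p z * Real.logb 2 (p z / ∑ u, p (u, z.2)) = -condEntropy p := by
  rw [condEntropy, neg_neg, Fintype.sum_prod_type]

theorem condEntropy_nonneg (hp : p ∈ stdSimplex ℝ (U × V)) : 0 ≤ condEntropy p := by
  rw [condEntropy, neg_nonneg]
  refine Finset.sum_nonpos fun u _ => Finset.sum_nonpos fun v _ => ?_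
  have h : p (u, v) ≤ ∑ u', p (u', v) :=
    Finset.single_le_sum (f := fun u' => p (u', v)) (fun u' _ => hp.1 _) (Finset.mem_univ u)
  exact mul_nonpos_of_nonneg_of_nonpos (hp.1 _) (Real.logb_nonpos one_lt_two
    (div_nonneg (hp.1 _) ((hp.1 _).trans h)) (div_le_one_of_le₀ h ((hp.1 _).trans h)))

/-- Links conditional probabilities of blocks to sums of letterwise logarithms. Blocks of
probability 0, where `Real.logb` takes a default value, are excluded; they carry no mass in the
limits below. -/
theorem sourceProb_eq_rpow_mul_sideProb (hp : p ∈ stdSimplex ℝ (U × V)) {n : ℕ} {u : Fin n → U}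
    {v : Fin n → V} (h : sourceProb p u v ≠ 0) :
    0 < sideProb p v ∧ sourceProb p u v =
      2 ^ (∑ i, Real.logb 2 (p (u i, v i) / ∑ u', p (u', v i))) * sideProb p v := by
  have hpos : ∀ i, 0 < p (u i, v i) := fun i =>
    (hp.1 _).lt_of_ne' (Finset.prod_ne_zero_iff.1 h i (Finset.mem_univ i))
  have hside : ∀ i, 0 < ∑ u', p (u', v i) := fun i => (hpos i).trans_le
    (Finset.single_le_sum (f := fun u' => p (u', v i)) (fun u' _ => hp.1 _)
      (Finset.mem_univ (u i)))
  refine ⟨Finset.prod_pos fun i _ => hside i, ?_⟩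
  rw [Real.rpow_sum_of_pos two_pos, sideProb, ← Finset.prod_mul_distrib, sourceProb]
  refine Finset.prod_congr rfl fun i _ => ?_
  rw [Real.rpow_logb two_pos (by norm_num) (div_pos (hpos i) (hside i)),
    div_mul_cancel₀ _ (hside i).ne']

-- For the converse: given the side information, no source block is too easy to guess. Multiplying
-- by `sideProb` avoids dividing by a side probability that may vanish.
open Classical in
theorem tendsto_prob_condProb_gt (hp : p ∈ stdSimplex ℝ (U × V)) {a : ℝ}
    (ha : a < condEntropy p) :
    Tendsto (fun n : ℕ => ∑ u : Fin n → U, ∑ v : Fin n → V,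
      if (2 : ℝ) ^ (-(n * a)) * sideProb p v < sourceProb p u v then sourceProb p u v else 0)
      atTop (𝓝 0) := by
  have hlim := tendsto_sum_deviation hp.1 hp.2
    (f := fun z => Real.logb 2 (p z / ∑ u, p (u, z.2))) (a := -a)
    (by rw [condEntropy_eq]; linarith)
  refine squeeze_zero (fun n => Finset.sum_nonneg fun u _ => Finset.sum_nonneg fun v _ => ?_)
    (fun n => ?_) hlim
  · split_ifs
    · exact sourceProb_nonneg hp u v
    · exact le_rfl
  · rw [← sum_block_pairs]
    refine Finset.sum_le_sum fun z _ => ?_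
    have h0 : 0 ≤ ∏ i, p (z i) := Finset.prod_nonneg fun i _ => hp.1 _
    split_ifs with h1 h2 h2
    · exact le_rfl
    · by_contra! hne
      obtain ⟨hs, he⟩ := sourceProb_eq_rpow_mul_sideProb hp hne.ne'
      rw [he, mul_lt_mul_iff_left₀ hs, Real.rpow_lt_rpow_left_iff one_lt_two] at h1
      apply h2
      simp only [Prod.mk.eta] at h1
      linarith
    · exact h0
    · exact le_rfl

-- For binning: the true block is usually among the few that are likely given the side information.
open Classical in
theorem tendsto_prob_condProb_lt (hp : p ∈ stdSimplex ℝ (U × V)) {a : ℝ}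
    (ha : condEntropy p < a) :
    Tendsto (fun n : ℕ => ∑ u : Fin n → U, ∑ v : Fin n → V,
      if sourceProb p u v < (2 : ℝ) ^ (-(n * a)) * sideProb p v then sourceProb p u v else 0)
      atTop (𝓝 0) := by
  have hlim := tendsto_sum_deviation hp.1 hp.2
    (f := fun z => -Real.logb 2 (p z / ∑ u, p (u, z.2))) (a := a)
    (by simp only [mul_neg, Finset.sum_neg_distrib]; rw [condEntropy_eq]; linarith)
  refine squeeze_zero (fun n => Finset.sum_nonneg fun u _ => Finset.sum_nonneg fun v _ => ?_)
    (fun n => ?_) hlim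
  · split_ifs
    · exact sourceProb_nonneg hp u v
    · exact le_rfl
  · rw [← sum_block_pairs]
    refine Finset.sum_le_sum fun z _ => ?_
    have h0 : 0 ≤ ∏ i, p (z i) := Finset.prod_nonneg fun i _ => hp.1 _
    split_ifs with h1 h2 h2
    · exact le_rfl
    · by_contra! hne
      obtain ⟨hs, he⟩ := sourceProb_eq_rpow_mul_sideProb hp hne.ne'
      rw [he, mul_lt_mul_iff_left₀ hs, Real.rpow_lt_rpow_left_iff one_lt_two] at h1
      apply h2
      simp only [Prod.mk.eta] at h1
      rw [Finset.sum_neg_distrib]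
      linarith
    · exact h0
    · exact le_rfl

end Source

/-! ### Random coding over a point-to-point channel -/

section Threshold

variable {A B : Type*} {M : ℕ} [NeZero M]

open Classical in
/-- The decoder that outputs a message whose codeword makes the observed output more likely
than the threshold `T`. -/
noncomputable def thresholdDec (K : A → B → ℝ) (T : B → ℝ) (C : Fin M → A) (y : B) : Fin M :=
  if h : ∃ w, T y < K (C w) y then h.choose else 0

-- An error requires that the true codeword miss the threshold or that some other codeword pass it,
-- whichever passing message the decoder picks.
open Classical in
theorem thresholdDec_error_le (K : A → B → ℝ) (T : B → ℝ) (C : Fin M → A) (y : B) (w : Fin M)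
    (hK : ∀ a, 0 ≤ K a y) :
    (if thresholdDec K T C y ≠ w then K (C w) y else 0) ≤
      (if K (C w) y ≤ T y then K (C w) y else 0) +
        ∑ w' ∈ Finset.univ.erase w, K (C w) y * (if T y < K (C w') y then 1 else 0) := by
  have hs : ∀ w' ∈ Finset.univ.erase w,
      0 ≤ K (C w) y * (if T y < K (C w') y then (1 : ℝ) else 0) := fun w' _ =>
    mul_nonneg (hK _) (by split_ifs <;> norm_num)
  by_cases hw : K (C w) y ≤ T y
  · rw [if_pos hw]
    refine le_add_of_le_of_nonneg ?_ (Finset.sum_nonneg hs)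
    split_ifs
    exacts [le_rfl, hK _]
  · rw [if_neg hw, zero_add]
    split_ifs with hd
    · have hex : ∃ w, T y < K (C w) y := ⟨w, not_le.1 hw⟩
      have hdec : thresholdDec K T C y = hex.choose := dif_pos hex
      refine le_trans (le_of_eq ?_) (Finset.single_le_sum hs
        (Finset.mem_erase.2 ⟨hd, Finset.mem_univ (thresholdDec K T C y)⟩))
      rw [hdec, if_pos hex.choose_spec, mul_one]
    · exact Finset.sum_nonneg hs

-- A wrong codeword is independent of the output, whose law is `Q = ∑ P K`; by Markov's inequality
-- it passes the threshold `γ Q` with probability at most `1/γ`. The count `M - 1` of wrong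
-- messages, rather than `M`, is needed when there is a single message and `γ` is small.
open Classical in
theorem randAvg_thresholdDec_error_le [Fintype A] [Fintype B] {P : A → ℝ} (hP0 : ∀ a, 0 ≤ P a)
    (hP : ∑ a, P a = 1) {K : A → B → ℝ} (hK0 : ∀ a b, 0 ≤ K a b) (hK : ∀ a, ∑ b, K a b = 1)
    {γ : ℝ} (hγ : 0 < γ) (w : Fin M) :
    (randAvg P fun C : Fin M → A => ∑ y,
      if thresholdDec K (fun b => γ * ∑ a, P a * K a b) C y ≠ w then K (C w) y else 0) ≤
      (∑ a, P a * ∑ y, if K a y ≤ γ * ∑ a', P a' * K a' y then K a y else 0) +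
        ((M : ℝ) - 1) / γ := by
  set Q : B → ℝ := fun b => ∑ a, P a * K a b with hQ
  have hQ0 : ∀ b, 0 ≤ Q b := fun b => Finset.sum_nonneg fun a _ => mul_nonneg (hP0 a) (hK0 a b)
  have hQ1 : ∑ b, Q b = 1 := by
    rw [hQ, Finset.sum_comm]
    simp only [← Finset.mul_sum, hK, mul_one, hP]
  have hpt : ∀ C : Fin M → A, (∑ y, if thresholdDec K (fun b => γ * Q b) C y ≠ w
      then K (C w) y else 0) ≤
      (∑ y, if K (C w) y ≤ γ * Q y then K (C w) y else 0) +
        ∑ w' ∈ Finset.univ.erase w, ∑ y,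
          K (C w) y * (if γ * Q y < K (C w') y then 1 else 0) := by
    intro C
    rw [Finset.sum_comm, ← Finset.sum_add_distrib]
    exact Finset.sum_le_sum fun y _ => thresholdDec_error_le K _ C y w fun a => hK0 a y
  refine (randAvg_mono hP0 hpt).trans ?_
  rw [randAvg_add, randAvg_apply hP w (fun a => ∑ y, if K a y ≤ γ * Q y then K a y else 0),
    randAvg_sum]
  refine add_le_add le_rfl ?_
  have hterm : ∀ w' ∈ Finset.univ.erase w, (randAvg P fun C : Fin M → A => ∑ y,
      K (C w) y * (if γ * Q y < K (C w') y then 1 else 0)) ≤ 1 / γ := by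
    intro w' hw'
    have h1 : 1 / γ = ∑ y, Q y / γ := by rw [← Finset.sum_div, hQ1]
    rw [randAvg_sum, h1]
    refine Finset.sum_le_sum fun y _ => ?_
    rw [randAvg_apply_mul_apply hP (Finset.ne_of_mem_erase hw').symm (fun a => K a y)
      (fun a => if γ * Q y < K a y then 1 else 0), le_div_iff₀ hγ, mul_right_comm, mul_comm,
      Finset.sum_mul]
    refine Finset.sum_le_sum fun a _ => ?_
    change P a * _ * (Q y * γ) ≤ _
    rw [mul_assoc]
    refine mul_le_mul_of_nonneg_left ?_ (hP0 a)
    split_ifs with h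
    · linarith
    · simpa using hK0 a y
  refine (Finset.sum_le_sum hterm).trans (le_of_eq ?_)
  rw [Finset.sum_const, Finset.card_erase_of_mem (Finset.mem_univ w), Finset.card_univ,
    Fintype.card_fin, nsmul_eq_mul, Nat.cast_sub (NeZero.one_le), Nat.cast_one]
  ring

end Threshold

open Classical in
/-- If a source with side information is recovered from the channel output, then the output is
much more likely given the source symbol than on average. -/
theorem prob_le_threshold_le {U V Y : Type*} [Fintype U] [DecidableEq U] [Fintype V] [Fintype Y]
    {S : U → V → ℝ} (hS0 : ∀ u v, 0 ≤ S u v) (hS : ∑ u, ∑ v, S u v = 1) {K : U → Y → ℝ}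
    (hK0 : ∀ u y, 0 ≤ K u y) (hK : ∀ u, ∑ y, K u y = 1) (g : Y → V → U) {τ γ : ℝ}
    (hτ : 0 ≤ τ) (hγ : 0 ≤ γ) :
    (∑ u, (∑ v, S u v) * ∑ y, if K u y ≤ γ * ∑ u', (∑ v, S u' v) * K u' y then K u y else 0) ≤
      (∑ u, ∑ v, ∑ y, if g y v ≠ u then S u v * K u y else 0) +
        (∑ u, ∑ v, if τ * ∑ u', S u' v < S u v then S u v else 0) + τ * γ := by
  set Q : Y → ℝ := fun y => ∑ u', (∑ v, S u' v) * K u' y with hQ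
  have hQ1 : ∑ y, Q y = 1 := by
    rw [hQ, Finset.sum_comm]
    simp only [← Finset.mul_sum, hK, mul_one, hS]
  have hQ0 : ∀ y, 0 ≤ Q y := fun y => Finset.sum_nonneg fun u _ =>
    mul_nonneg (Finset.sum_nonneg fun v _ => hS0 u v) (hK0 u y)
  have hV0 : ∀ v, 0 ≤ ∑ u', S u' v := fun v => Finset.sum_nonneg fun u _ => hS0 u v
  have hatyp : (∑ u, ∑ v, if τ * ∑ u', S u' v < S u v then S u v else 0) =
      ∑ u, ∑ v, ∑ y, (if τ * ∑ u', S u' v < S u v then S u v else 0) * K u y := by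
    simp only [← Finset.mul_sum, hK, mul_one]
  -- Each pair `(y, v)` is decoded to exactly one `u`, so these products of side and output
  -- probabilities have total `τ γ`. They dominate the mass that is correctly decoded, not too
  -- likely given `v`, and below the threshold.
  have hlast : τ * γ = ∑ u, ∑ v, ∑ y,
      if g y v = u then τ * (∑ u', S u' v) * (γ * Q y) else 0 := by
    rw [Finset.sum_comm]
    simp_rw [Finset.sum_comm (s := (Finset.univ : Finset U)) (t := (Finset.univ : Finset Y)),
      Finset.sum_ite_eq, Finset.mem_univ, if_true, ← Finset.mul_sum, hQ1, ← Finset.sum_mul,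
      ← Finset.mul_sum]
    rw [Finset.sum_comm, hS]
    ring
  rw [hatyp, hlast, ← Finset.sum_add_distrib, ← Finset.sum_add_distrib]
  refine Finset.sum_le_sum fun u _ => ?_
  rw [Finset.sum_mul, ← Finset.sum_add_distrib, ← Finset.sum_add_distrib]
  refine Finset.sum_le_sum fun v _ => ?_
  rw [Finset.mul_sum, ← Finset.sum_add_distrib, ← Finset.sum_add_distrib]
  refine Finset.sum_le_sum fun y _ => ?_
  have hSK := mul_nonneg (hS0 u v) (hK0 u y)
  have hprod : 0 ≤ τ * (∑ u', S u' v) * (γ * Q y) :=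
    mul_nonneg (mul_nonneg hτ (hV0 v)) (mul_nonneg hγ (hQ0 y))
  by_cases h1 : g y v = u
  · by_cases h2 : τ * ∑ u', S u' v < S u v
    · simp only [h1, h2, ne_eq, not_true_eq_false, if_true, if_false]
      split_ifs <;> linarith
    · simp only [h1, h2, ne_eq, not_true_eq_false, if_true, if_false]
      split_ifs with h3
      · have := mul_le_mul (not_lt.1 h2) h3 (hK0 u y) (mul_nonneg hτ (hV0 v))
        linarith
      · linarith
  · have h2 : 0 ≤ (if τ * ∑ u', S u' v < S u v then S u v else 0) * K u y :=
      mul_nonneg (by split_ifs <;> simp [hS0]) (hK0 u y)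
    simp only [h1, ne_eq, not_false_eq_true, if_true, if_false]
    split_ifs <;> split_ifs at h2 <;> linarith

/-! ### Random coding over an interference channel -/

-- Union bound over the receivers. Decoder 1 depends only on the first codebook, so averaging over
-- the second replaces `K` by `K₁`, which treats interference as noise; symmetrically for receiver
-- 2. Each receiver then has a point-to-point problem.
open Classical in
theorem exists_interference_code {A₁ A₂ B₁ B₂ : Type*} [Fintype A₁] [Fintype A₂] [Fintype B₁]
    [Fintype B₂] {M₁ M₂ : ℕ} [NeZero M₁] [NeZero M₂] {P₁ : A₁ → ℝ} {P₂ : A₂ → ℝ}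
    (hP₁0 : ∀ a, 0 ≤ P₁ a) (hP₁ : ∑ a, P₁ a = 1) (hP₂0 : ∀ a, 0 ≤ P₂ a) (hP₂ : ∑ a, P₂ a = 1)
    {K : A₁ → A₂ → B₁ → B₂ → ℝ} (hK0 : ∀ a₁ a₂ b₁ b₂, 0 ≤ K a₁ a₂ b₁ b₂)
    (hK : ∀ a₁ a₂, ∑ b₁, ∑ b₂, K a₁ a₂ b₁ b₂ = 1) {γ₁ γ₂ : ℝ} (hγ₁ : 0 < γ₁) (hγ₂ : 0 < γ₂)
    {K₁ : A₁ → B₁ → ℝ} (hK₁ : K₁ = fun a₁ b₁ => ∑ a₂, P₂ a₂ * ∑ b₂, K a₁ a₂ b₁ b₂)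
    {K₂ : A₂ → B₂ → ℝ} (hK₂ : K₂ = fun a₂ b₂ => ∑ a₁, P₁ a₁ * ∑ b₁, K a₁ a₂ b₁ b₂) :
    ∃ (C₁ : Fin M₁ → A₁) (C₂ : Fin M₂ → A₂) (d₁ : B₁ → Fin M₁) (d₂ : B₂ → Fin M₂),
      ((M₁ : ℝ) * (M₂ : ℝ))⁻¹ * ∑ w₁, ∑ w₂, ∑ y₁, ∑ y₂,
        (if (d₁ y₁, d₂ y₂) ≠ (w₁, w₂) then K (C₁ w₁) (C₂ w₂) y₁ y₂ else 0) ≤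
      ((∑ a, P₁ a * ∑ y, if K₁ a y ≤ γ₁ * ∑ a', P₁ a' * K₁ a' y then K₁ a y else 0) +
        ((M₁ : ℝ) - 1) / γ₁) +
      ((∑ a, P₂ a * ∑ y, if K₂ a y ≤ γ₂ * ∑ a', P₂ a' * K₂ a' y then K₂ a y else 0) +
        ((M₂ : ℝ) - 1) / γ₂) := by
  set E₁ := (∑ a, P₁ a * ∑ y, if K₁ a y ≤ γ₁ * ∑ a', P₁ a' * K₁ a' y then K₁ a y else 0) +
        ((M₁ : ℝ) - 1) / γ₁ with hE₁
  set E₂ := (∑ a, P₂ a * ∑ y, if K₂ a y ≤ γ₂ * ∑ a', P₂ a' * K₂ a' y then K₂ a y else 0) +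
        ((M₂ : ℝ) - 1) / γ₂ with hE₂
  have hK₁0 : ∀ a b, 0 ≤ K₁ a b := fun a b => by
    rw [hK₁]
    exact Finset.sum_nonneg fun _ _ => mul_nonneg (hP₂0 _) (Finset.sum_nonneg fun _ _ =>
      hK0 _ _ _ _)
  have hK₂0 : ∀ a b, 0 ≤ K₂ a b := fun a b => by
    rw [hK₂]
    exact Finset.sum_nonneg fun _ _ => mul_nonneg (hP₁0 _) (Finset.sum_nonneg fun _ _ =>
      hK0 _ _ _ _)
  have hK₁1 : ∀ a, ∑ b, K₁ a b = 1 := fun a => by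
    simp only [hK₁]
    rw [Finset.sum_comm]
    simp only [← Finset.mul_sum, hK, mul_one, hP₂]
  have hK₂1 : ∀ a, ∑ b, K₂ a b = 1 := fun a => by
    simp only [hK₂]
    rw [Finset.sum_comm]
    simp only [← Finset.mul_sum]
    rw [← hP₁]
    refine Finset.sum_congr rfl fun a₁ _ => ?_
    rw [Finset.sum_comm, hK, mul_one]
  let D₁ : (Fin M₁ → A₁) → B₁ → Fin M₁ :=
    thresholdDec K₁ (fun b => γ₁ * ∑ a, P₁ a * K₁ a b)
  let D₂ : (Fin M₂ → A₂) → B₂ → Fin M₂ :=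
    thresholdDec K₂ (fun b => γ₂ * ∑ a, P₂ a * K₂ a b)
  have h₁ : ∀ w₁, (randAvg P₁ fun C : Fin M₁ → A₁ => ∑ y,
      if D₁ C y ≠ w₁ then K₁ (C w₁) y else 0) ≤ E₁ := fun w₁ =>
    randAvg_thresholdDec_error_le hP₁0 hP₁ hK₁0 hK₁1 hγ₁ w₁
  have h₂ : ∀ w₂, (randAvg P₂ fun C : Fin M₂ → A₂ => ∑ y,
      if D₂ C y ≠ w₂ then K₂ (C w₂) y else 0) ≤ E₂ := fun w₂ =>
    randAvg_thresholdDec_error_le hP₂0 hP₂ hK₂0 hK₂1 hγ₂ w₂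
  obtain ⟨C₁, C₂, hC⟩ := exists_le_randAvg_randAvg hP₁0 hP₁ hP₂0 hP₂
    (fun (C₁ : Fin M₁ → A₁) (C₂ : Fin M₂ → A₂) =>
      ((M₁ : ℝ) * (M₂ : ℝ))⁻¹ * ∑ w₁, ∑ w₂, ∑ y₁, ∑ y₂,
        (if (D₁ C₁ y₁, D₂ C₂ y₂) ≠ (w₁, w₂) then K (C₁ w₁) (C₂ w₂) y₁ y₂ else 0))
  refine ⟨C₁, C₂, D₁ C₁, D₂ C₂, hC.trans ?_⟩
  have hM : (0 : ℝ) < (M₁ : ℝ) * M₂ :=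
    mul_pos (Nat.cast_pos.2 (NeZero.pos M₁)) (Nat.cast_pos.2 (NeZero.pos M₂))
  simp only [randAvg_const_mul, randAvg_sum]
  rw [inv_mul_le_iff₀ hM]
  have hw : ∀ w₁ w₂, (∑ y₁, ∑ y₂, randAvg P₁ fun C₁ : Fin M₁ → A₁ =>
      randAvg P₂ fun C₂ : Fin M₂ → A₂ =>
        if (D₁ C₁ y₁, D₂ C₂ y₂) ≠ (w₁, w₂) then K (C₁ w₁) (C₂ w₂) y₁ y₂ else 0) ≤ E₁ + E₂ := by
    intro w₁ w₂
    -- In each half of the union bound, the other user's codebook enters only through its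
    -- transmitted codeword and is averaged out.
    have hsplit : ∀ y₁ y₂, (randAvg P₁ fun C₁ : Fin M₁ → A₁ =>
        randAvg P₂ fun C₂ : Fin M₂ → A₂ =>
          if (D₁ C₁ y₁, D₂ C₂ y₂) ≠ (w₁, w₂) then K (C₁ w₁) (C₂ w₂) y₁ y₂ else 0) ≤
        (randAvg P₁ fun C₁ : Fin M₁ → A₁ => (if D₁ C₁ y₁ ≠ w₁ then 1 else 0) *
          ∑ a₂, P₂ a₂ * K (C₁ w₁) a₂ y₁ y₂) +
        randAvg P₂ fun C₂ : Fin M₂ → A₂ => (if D₂ C₂ y₂ ≠ w₂ then 1 else 0) *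
          ∑ a₁, P₁ a₁ * K a₁ (C₂ w₂) y₁ y₂ := by
      intro y₁ y₂
      have e₁ : ∀ C₁ : Fin M₁ → A₁, (if D₁ C₁ y₁ ≠ w₁ then (1 : ℝ) else 0) *
          ∑ a₂, P₂ a₂ * K (C₁ w₁) a₂ y₁ y₂ = randAvg P₂ fun C₂ : Fin M₂ → A₂ =>
            (if D₁ C₁ y₁ ≠ w₁ then (1 : ℝ) else 0) * K (C₁ w₁) (C₂ w₂) y₁ y₂ := fun C₁ => by
        rw [randAvg_const_mul, randAvg_apply hP₂ w₂ fun a => K (C₁ w₁) a y₁ y₂]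
      have e₂ : (randAvg P₂ fun C₂ : Fin M₂ → A₂ => (if D₂ C₂ y₂ ≠ w₂ then (1 : ℝ) else 0) *
          ∑ a₁, P₁ a₁ * K a₁ (C₂ w₂) y₁ y₂) = randAvg P₁ fun C₁ : Fin M₁ → A₁ =>
            randAvg P₂ fun C₂ : Fin M₂ → A₂ =>
            (if D₂ C₂ y₂ ≠ w₂ then (1 : ℝ) else 0) * K (C₁ w₁) (C₂ w₂) y₁ y₂ := by
        rw [randAvg_apply hP₁ w₁ fun a => randAvg P₂ fun C₂ : Fin M₂ → A₂ =>
            (if D₂ C₂ y₂ ≠ w₂ then (1 : ℝ) else 0) * K a (C₂ w₂) y₁ y₂]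
        simp only [← randAvg_const_mul, ← randAvg_sum, Finset.mul_sum]
        congr 1
        funext C₂
        exact Finset.sum_congr rfl fun a _ => by ring
      simp only [e₁, e₂, ← randAvg_add]
      refine randAvg_mono hP₁0 fun C₁ => randAvg_mono hP₂0 fun C₂ => ?_
      have := hK0 (C₁ w₁) (C₂ w₂) y₁ y₂
      by_cases g₁ : D₁ C₁ y₁ = w₁ <;> by_cases g₂ : D₂ C₂ y₂ = w₂ <;> simp [g₁, g₂, this]
    refine (Finset.sum_le_sum fun y₁ _ => Finset.sum_le_sum fun y₂ _ => hsplit y₁ y₂).trans ?_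
    simp only [Finset.sum_add_distrib]
    refine add_le_add (le_trans (le_of_eq ?_) (h₁ w₁)) (le_trans (le_of_eq ?_) (h₂ w₂))
    · simp only [← randAvg_sum]
      congr 1
      funext C₁
      refine Finset.sum_congr rfl fun y₁ _ => ?_
      rw [← Finset.mul_sum, Finset.sum_comm, hK₁]
      simp only [← Finset.mul_sum, ite_mul, one_mul, zero_mul]
    · rw [Finset.sum_comm]
      simp only [← randAvg_sum]
      congr 1
      funext C₂
      refine Finset.sum_congr rfl fun y₂ _ => ?_
      rw [← Finset.mul_sum, Finset.sum_comm, hK₂]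
      simp only [← Finset.mul_sum, ite_mul, one_mul, zero_mul]
  refine (Finset.sum_le_sum fun w₁ _ => Finset.sum_le_sum fun w₂ _ => hw w₁ w₂).trans
    (le_of_eq ?_)
  simp
  ring

/-! ### Random binning -/

section Binning

variable {U V : Type*} {M : ℕ}

open Classical in
/-- The decoder that outputs a source symbol in the given bin that is likely given the side
information. -/
noncomputable def binDec [Nonempty U] (S T : U → V → ℝ) (s : U → Fin M) (m : Fin M) (v : V) : U :=
  if h : ∃ u, s u = m ∧ T u v ≤ S u v then h.choose else Classical.arbitrary U

-- At most `1/θ` source symbols have conditional probability at least `θ` given `v`, and each one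
-- other than the true symbol falls in its bin with probability `1/M`.
open Classical in
theorem randAvg_binDec_error_le [Nonempty U] [Fintype U] [DecidableEq U] [Fintype V] [NeZero M]
    {S : U → V → ℝ} (hS0 : ∀ u v, 0 ≤ S u v) (hS : ∑ u, ∑ v, S u v = 1) {θ : ℝ} (hθ : 0 < θ) :
    (randAvg (fun _ : Fin M => (M : ℝ)⁻¹) fun s : U → Fin M => ∑ u, ∑ v,
      if binDec S (fun _ v => θ * ∑ u', S u' v) s (s u) v ≠ u then S u v else 0) ≤
      (∑ u, ∑ v, if S u v < θ * ∑ u', S u' v then S u v else 0) + 1 / (θ * M) := by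
  have hM : (0 : ℝ) < M := Nat.cast_pos.2 (NeZero.pos M)
  have hP : ∑ _ : Fin M, (M : ℝ)⁻¹ = 1 := by simp [hM.ne']
  have hP0 : ∀ _ : Fin M, (0 : ℝ) ≤ (M : ℝ)⁻¹ := fun _ => inv_nonneg.2 hM.le
  set T : U → V → ℝ := fun _ v => θ * ∑ u', S u' v with hT
  -- The sum over `m` is the indicator of `s u = s u'`, written in products to which independence of
  -- two values applies.
  have hpt : ∀ s : U → Fin M, (∑ u, ∑ v, if binDec S T s (s u) v ≠ u then S u v else 0) ≤
      (∑ u, ∑ v, if S u v < T u v then S u v else 0) +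
      ∑ u, ∑ v, ∑ u' ∈ Finset.univ.erase u,
        (S u v * if T u' v ≤ S u' v then 1 else 0) *
          ∑ m, (if s u = m then 1 else 0) * (if s u' = m then 1 else 0) := by
    intro s
    rw [← Finset.sum_add_distrib]
    refine Finset.sum_le_sum fun u _ => ?_
    rw [← Finset.sum_add_distrib]
    refine Finset.sum_le_sum fun v _ => ?_
    have hs : ∀ u' ∈ Finset.univ.erase u, 0 ≤ (S u v * if T u' v ≤ S u' v then (1 : ℝ) else 0) *
          ∑ m, (if s u = m then 1 else 0) * (if s u' = m then 1 else 0) := fun u' _ =>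
      mul_nonneg (mul_nonneg (hS0 u v) (by split_ifs <;> norm_num))
        (Finset.sum_nonneg fun m _ => mul_nonneg (by split_ifs <;> norm_num)
          (by split_ifs <;> norm_num))
    by_cases hu : S u v < T u v
    · rw [if_pos hu]
      refine le_add_of_le_of_nonneg ?_ (Finset.sum_nonneg hs)
      split_ifs
      exacts [le_rfl, hS0 _ _]
    · rw [if_neg hu, zero_add]
      split_ifs with hd
      · have hex : ∃ u', s u' = s u ∧ T u' v ≤ S u' v := ⟨u, rfl, not_lt.1 hu⟩
        have hdec : binDec S T s (s u) v = hex.choose := dif_pos hex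
        refine le_trans (le_of_eq ?_) (Finset.single_le_sum hs
          (Finset.mem_erase.2 ⟨hd, Finset.mem_univ (binDec S T s (s u) v)⟩))
        rw [hdec, if_pos hex.choose_spec.2, hex.choose_spec.1]
        simp
      · exact Finset.sum_nonneg hs
  refine (randAvg_mono hP0 hpt).trans ?_
  rw [randAvg_add, randAvg_const hP]
  refine add_le_add le_rfl ?_
  simp only [randAvg_sum, randAvg_const_mul]
  have hcol : ∀ v, ∑ u, ∑ u' ∈ Finset.univ.erase u,
      (S u v * if T u' v ≤ S u' v then 1 else 0) * ∑ m : Fin M,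
        randAvg (fun _ : Fin M => (M : ℝ)⁻¹)
        (fun s : U → Fin M => (if s u = m then 1 else 0) * (if s u' = m then 1 else 0)) ≤
      (∑ u, S u v) * (1 / (θ * M)) := by
    intro v
    rw [Finset.sum_mul]
    refine Finset.sum_le_sum fun u _ => ?_
    have hb : ∀ u' ∈ Finset.univ.erase u, (S u v * if T u' v ≤ S u' v then 1 else 0) *
        ∑ m : Fin M, randAvg (fun _ : Fin M => (M : ℝ)⁻¹)
        (fun s : U → Fin M => (if s u = m then 1 else 0) * (if s u' = m then 1 else 0)) =
        S u v * ((if T u' v ≤ S u' v then 1 else 0) * (M : ℝ)⁻¹) := by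
      intro u' hu'
      have : ∀ m : Fin M, randAvg (fun _ : Fin M => (M : ℝ)⁻¹)
        (fun s : U → Fin M => (if s u = m then 1 else 0) * (if s u' = m then 1 else 0)) =
          (M : ℝ)⁻¹ * (M : ℝ)⁻¹ := fun m => by
        rw [randAvg_apply_mul_apply hP (Finset.ne_of_mem_erase hu').symm
          (fun a => if a = m then 1 else 0) (fun a => if a = m then 1 else 0)]
        simp
      simp only [this, Finset.sum_const, Finset.card_univ, Fintype.card_fin, nsmul_eq_mul]
      field_simp
    rw [Finset.sum_congr rfl hb, ← Finset.mul_sum, ← Finset.sum_mul]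
    rcases (hS0 u v).eq_or_lt with h0 | hpos
    · simp [← h0]
    refine mul_le_mul_of_nonneg_left ?_ hpos.le
    have hside : 0 < ∑ u', S u' v := hpos.trans_le
      (Finset.single_le_sum (f := fun u' => S u' v) (fun u' _ => hS0 u' v) (Finset.mem_univ u))
    have hcount : (∑ u' ∈ Finset.univ.erase u, if T u' v ≤ S u' v then (1 : ℝ) else 0) * θ ≤
        1 := by
      refine le_of_mul_le_mul_right ?_ hside
      rw [one_mul, mul_assoc, Finset.sum_mul]
      refine le_trans ?_ (Finset.sum_le_sum_of_subset_of_nonneg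
        (Finset.erase_subset u Finset.univ) fun u' _ _ => hS0 u' v)
      refine Finset.sum_le_sum fun u' _ => ?_
      split_ifs with h
      · rw [one_mul]; exact h
      · simpa using hS0 u' v
    rw [one_div, mul_inv]
    refine mul_le_mul_of_nonneg_right ?_ (inv_nonneg.2 hM.le)
    rwa [← one_div, le_div_iff₀ hθ]
  rw [Finset.sum_comm]
  refine (Finset.sum_le_sum fun v _ => hcol v).trans (le_of_eq ?_)
  rw [← Finset.sum_mul, Finset.sum_comm, hS, one_mul]

end Binning

/-! ### Reordering of sums and the block channel. -/

theorem sum_comm_two_one {α β γ : Type*} [Fintype α] [Fintype β] [Fintype γ]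
    (F : α → β → γ → ℝ) : ∑ a, ∑ b, ∑ c, F a b c = ∑ c, ∑ a, ∑ b, F a b c :=
  (Finset.sum_congr rfl fun _ _ => Finset.sum_comm).trans Finset.sum_comm

theorem sum_comm_two_two {α β γ δ : Type*} [Fintype α] [Fintype β] [Fintype γ] [Fintype δ]
    (F : α → β → γ → δ → ℝ) :
    ∑ a, ∑ b, ∑ c, ∑ d, F a b c d = ∑ c, ∑ d, ∑ a, ∑ b, F a b c d :=
  (sum_comm_two_one _).trans (Finset.sum_congr rfl fun _ _ => sum_comm_two_one _)

section Coding

variable {U₁ V₁ U₂ V₂ X₁ X₂ Y₁ Y₂ : Type*} [Fintype U₁] [Fintype V₁] [Fintype U₂] [Fintype V₂]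
  [Fintype Y₁] [Fintype Y₂] {p₁ : U₁ × V₁ → ℝ} {p₂ : U₂ × V₂ → ℝ} {W : X₁ → X₂ → Y₁ × Y₂ → ℝ}

theorem channelProb_nonneg (hW : ∀ x₁ x₂, W x₁ x₂ ∈ stdSimplex ℝ (Y₁ × Y₂)) {n : ℕ}
    (x₁ : Fin n → X₁) (x₂ : Fin n → X₂) (y₁ : Fin n → Y₁) (y₂ : Fin n → Y₂) :
    0 ≤ channelProb W x₁ x₂ y₁ y₂ :=
  Finset.prod_nonneg fun _ _ => (hW _ _).1 _

theorem sum_channelProb (hW : ∀ x₁ x₂, W x₁ x₂ ∈ stdSimplex ℝ (Y₁ × Y₂)) {n : ℕ}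
    (x₁ : Fin n → X₁) (x₂ : Fin n → X₂) : ∑ y₁, ∑ y₂, channelProb W x₁ x₂ y₁ y₂ = 1 := by
  rw [← sum_block_pairs]
  simp only [channelProb, Prod.mk.eta]
  rw [← Fintype.piFinset_univ, ← Finset.prod_univ_sum (fun _ => Finset.univ)
    (fun i y => W (x₁ i) (x₂ i) y)]
  exact Finset.prod_eq_one fun i _ => (hW _ _).2

/-! ### The converse: channel codes from joint codes -/

-- Receiver 1's error is part of the joint error event. Averaging over user 2 yields the channel
-- from `U₁ⁿ` to `Y₁ⁿ` to which `prob_le_threshold_le` applies.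
open Classical in
theorem JointCode.sum_error₁_le (hp₁ : p₁ ∈ stdSimplex ℝ (U₁ × V₁))
    (hp₂ : p₂ ∈ stdSimplex ℝ (U₂ × V₂)) (hW : ∀ x₁ x₂, W x₁ x₂ ∈ stdSimplex ℝ (Y₁ × Y₂)) {n : ℕ}
    (c : JointCode U₁ V₁ U₂ V₂ X₁ X₂ Y₁ Y₂ n) :
    (∑ u₁, ∑ v₁, ∑ y₁, if c.dec₁ y₁ v₁ ≠ u₁ then sourceProb p₁ u₁ v₁ *
      ∑ u₂, (∑ v₂, sourceProb p₂ u₂ v₂) * ∑ y₂, channelProb W (c.enc₁ u₁) (c.enc₂ u₂) y₁ y₂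
      else 0) ≤ c.errorProb p₁ p₂ W := by
  refine Finset.sum_le_sum fun u₁ _ => Finset.sum_le_sum fun v₁ _ => ?_
  rw [sum_comm_two_one]
  refine Finset.sum_le_sum fun y₁ _ => ?_
  split_ifs with h
  · rw [Finset.mul_sum]
    refine Finset.sum_le_sum fun u₂ _ => ?_
    rw [Finset.sum_mul, Finset.mul_sum]
    refine Finset.sum_le_sum fun v₂ _ => ?_
    rw [Finset.mul_sum, Finset.mul_sum]
    refine Finset.sum_le_sum fun y₂ _ => ?_
    rw [if_pos (fun h' => h (congrArg Prod.fst h')), mul_assoc]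
  · refine Finset.sum_nonneg fun u₂ _ => Finset.sum_nonneg fun v₂ _ => Finset.sum_nonneg
      fun y₂ _ => ?_
    split_ifs
    · exact mul_nonneg (mul_nonneg (sourceProb_nonneg hp₁ _ _) (sourceProb_nonneg hp₂ _ _))
        (channelProb_nonneg hW _ _ _ _)
    · exact le_rfl

open Classical in
theorem JointCode.sum_error₂_le (hp₁ : p₁ ∈ stdSimplex ℝ (U₁ × V₁))
    (hp₂ : p₂ ∈ stdSimplex ℝ (U₂ × V₂)) (hW : ∀ x₁ x₂, W x₁ x₂ ∈ stdSimplex ℝ (Y₁ × Y₂)) {n : ℕ}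
    (c : JointCode U₁ V₁ U₂ V₂ X₁ X₂ Y₁ Y₂ n) :
    (∑ u₂, ∑ v₂, ∑ y₂, if c.dec₂ y₂ v₂ ≠ u₂ then sourceProb p₂ u₂ v₂ *
      ∑ u₁, (∑ v₁, sourceProb p₁ u₁ v₁) * ∑ y₁, channelProb W (c.enc₁ u₁) (c.enc₂ u₂) y₁ y₂
      else 0) ≤ c.errorProb p₁ p₂ W := by
  rw [JointCode.errorProb, sum_comm_two_two]
  refine Finset.sum_le_sum fun u₂ _ => Finset.sum_le_sum fun v₂ _ => ?_
  simp_rw [Finset.sum_comm (s := (Finset.univ : Finset (Fin n → Y₁)))]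
  rw [sum_comm_two_one]
  refine Finset.sum_le_sum fun y₂ _ => ?_
  split_ifs with h
  · rw [Finset.mul_sum]
    refine Finset.sum_le_sum fun u₁ _ => ?_
    rw [Finset.sum_mul, Finset.mul_sum]
    refine Finset.sum_le_sum fun v₁ _ => ?_
    rw [Finset.mul_sum, Finset.mul_sum]
    refine Finset.sum_le_sum fun y₁ _ => ?_
    rw [if_pos (fun h' => h (congrArg Prod.snd h')), mul_left_comm, ← mul_assoc]
  · refine Finset.sum_nonneg fun u₁ _ => Finset.sum_nonneg fun v₁ _ => Finset.sum_nonneg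
      fun y₁ _ => ?_
    split_ifs
    · exact mul_nonneg (mul_nonneg (sourceProb_nonneg hp₁ _ _) (sourceProb_nonneg hp₂ _ _))
        (channelProb_nonneg hW _ _ _ _)
    · exact le_rfl

-- The random codewords are encoded source blocks, so both induced channels agree with those of the
-- joint code, and the probability of missing the threshold is controlled by the joint error
-- probability.
open Classical in
theorem JointCode.exists_channelCode (hp₁ : p₁ ∈ stdSimplex ℝ (U₁ × V₁))
    (hp₂ : p₂ ∈ stdSimplex ℝ (U₂ × V₂)) (hW : ∀ x₁ x₂, W x₁ x₂ ∈ stdSimplex ℝ (Y₁ × Y₂)) {n : ℕ}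
    (c : JointCode U₁ V₁ U₂ V₂ X₁ X₂ Y₁ Y₂ n) (M₁ M₂ : ℕ) [NeZero M₁] [NeZero M₂]
    {τ₁ γ₁ τ₂ γ₂ : ℝ} (hτ₁ : 0 ≤ τ₁) (hγ₁ : 0 < γ₁) (hτ₂ : 0 ≤ τ₂) (hγ₂ : 0 < γ₂) :
    ∃ d : ChannelCode X₁ X₂ Y₁ Y₂ n M₁ M₂, d.errorProb W ≤
      (c.errorProb p₁ p₂ W + (∑ u : Fin n → U₁, ∑ v : Fin n → V₁,
        if τ₁ * sideProb p₁ v < sourceProb p₁ u v then sourceProb p₁ u v else 0) + τ₁ * γ₁ +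
        ((M₁ : ℝ) - 1) / γ₁) +
      (c.errorProb p₁ p₂ W + (∑ u : Fin n → U₂, ∑ v : Fin n → V₂,
        if τ₂ * sideProb p₂ v < sourceProb p₂ u v then sourceProb p₂ u v else 0) + τ₂ * γ₂ +
        ((M₂ : ℝ) - 1) / γ₂) := by
  have hS₁ := sum_sourceProb hp₁ n
  have hS₂ := sum_sourceProb hp₂ n
  have hK := fun u₁ u₂ => sum_channelProb hW (c.enc₁ u₁) (c.enc₂ u₂)
  have hK0 := fun u₁ u₂ => channelProb_nonneg hW (c.enc₁ u₁) (c.enc₂ u₂)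
  have hP₁0 : ∀ u₁ : Fin n → U₁, 0 ≤ ∑ v₁, sourceProb p₁ u₁ v₁ := fun u =>
    Finset.sum_nonneg fun v _ => sourceProb_nonneg hp₁ u v
  have hP₂0 : ∀ u₂ : Fin n → U₂, 0 ≤ ∑ v₂, sourceProb p₂ u₂ v₂ := fun u =>
    Finset.sum_nonneg fun v _ => sourceProb_nonneg hp₂ u v
  obtain ⟨C₁, C₂, d₁, d₂, hd⟩ := exists_interference_code (M₁ := M₁) (M₂ := M₂)
    hP₁0 hS₁ hP₂0 hS₂ hK0 hK hγ₁ hγ₂ rfl rfl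
  refine ⟨⟨fun w => c.enc₁ (C₁ w), fun w => c.enc₂ (C₂ w), d₁, d₂⟩, hd.trans ?_⟩
  have b₁ := prob_le_threshold_le (fun u v => sourceProb_nonneg hp₁ u v) hS₁
    (K := fun u₁ y₁ => ∑ u₂, (∑ v₂, sourceProb p₂ u₂ v₂) *
      ∑ y₂, channelProb W (c.enc₁ u₁) (c.enc₂ u₂) y₁ y₂)
    (fun u₁ y₁ => Finset.sum_nonneg fun u₂ _ => mul_nonneg (hP₂0 u₂)
      (Finset.sum_nonneg fun y₂ _ => hK0 u₁ u₂ y₁ y₂))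
    (fun u₁ => by
      rw [Finset.sum_comm]
      simp only [← Finset.mul_sum, hK, mul_one, hS₂]) c.dec₁ hτ₁ hγ₁.le
  have b₂ := prob_le_threshold_le (fun u v => sourceProb_nonneg hp₂ u v) hS₂
    (K := fun u₂ y₂ => ∑ u₁, (∑ v₁, sourceProb p₁ u₁ v₁) *
      ∑ y₁, channelProb W (c.enc₁ u₁) (c.enc₂ u₂) y₁ y₂)
    (fun u₂ y₂ => Finset.sum_nonneg fun u₁ _ => mul_nonneg (hP₁0 u₁)
      (Finset.sum_nonneg fun y₁ _ => hK0 u₁ u₂ y₁ y₂))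
    (fun u₂ => by
      rw [Finset.sum_comm, ← hS₁]
      simp only [← Finset.mul_sum]
      refine Finset.sum_congr rfl fun u₁ _ => ?_
      rw [Finset.sum_comm, hK, mul_one]) c.dec₂ hτ₂ hγ₂.le
  have e₁ := c.sum_error₁_le hp₁ hp₂ hW
  have e₂ := c.sum_error₂_le hp₁ hp₂ hW
  simp only [sum_sourceProb_eq_sideProb] at b₁ b₂
  exact add_le_add (add_le_add (b₁.trans (add_le_add_left (add_le_add_left e₁ _) _)) le_rfl)
    (add_le_add (b₂.trans (add_le_add_left (add_le_add_left e₂ _) _)) le_rfl)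

/-! ### Separate coding -/

open Classical in
/-- The probability that the messages `w₁`, `w₂` are not both decoded correctly. -/
noncomputable def ChannelCode.messageErrorProb {n M₁ M₂ : ℕ}
    (c : ChannelCode X₁ X₂ Y₁ Y₂ n M₁ M₂) (W : X₁ → X₂ → Y₁ × Y₂ → ℝ) (w₁ : Fin M₁)
    (w₂ : Fin M₂) : ℝ :=
  ∑ y₁ : Fin n → Y₁, ∑ y₂ : Fin n → Y₂, if (c.dec₁ y₁, c.dec₂ y₂) ≠ (w₁, w₂) then
    channelProb W (c.enc₁ w₁) (c.enc₂ w₂) y₁ y₂ else 0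

theorem ChannelCode.messageErrorProb_nonneg
    (hW : ∀ x₁ x₂, W x₁ x₂ ∈ stdSimplex ℝ (Y₁ × Y₂)) {n M₁ M₂ : ℕ}
    (c : ChannelCode X₁ X₂ Y₁ Y₂ n M₁ M₂) (w₁ : Fin M₁) (w₂ : Fin M₂) :
    0 ≤ c.messageErrorProb W w₁ w₂ :=
  Finset.sum_nonneg fun _ _ => Finset.sum_nonneg fun _ _ => by
    split_ifs
    exacts [channelProb_nonneg hW _ _ _ _, le_rfl]

theorem SlepianWolfCode.errorProb_nonneg (hp₁ : p₁ ∈ stdSimplex ℝ (U₁ × V₁)) {n M : ℕ}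
    (s : SlepianWolfCode U₁ V₁ n M) : 0 ≤ s.errorProb p₁ :=
  Finset.sum_nonneg fun _ _ => Finset.sum_nonneg fun _ _ => by
    split_ifs
    exacts [sourceProb_nonneg hp₁ _ _, le_rfl]

theorem JointCode.errorProb_nonneg (hp₁ : p₁ ∈ stdSimplex ℝ (U₁ × V₁))
    (hp₂ : p₂ ∈ stdSimplex ℝ (U₂ × V₂)) (hW : ∀ x₁ x₂, W x₁ x₂ ∈ stdSimplex ℝ (Y₁ × Y₂)) {n : ℕ}
    (c : JointCode U₁ V₁ U₂ V₂ X₁ X₂ Y₁ Y₂ n) : 0 ≤ c.errorProb p₁ p₂ W :=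
  Finset.sum_nonneg fun _ _ => Finset.sum_nonneg fun _ _ => Finset.sum_nonneg fun _ _ =>
    Finset.sum_nonneg fun _ _ => Finset.sum_nonneg fun _ _ => Finset.sum_nonneg fun _ _ => by
      split_ifs
      exacts [mul_nonneg (mul_nonneg (sourceProb_nonneg hp₁ _ _) (sourceProb_nonneg hp₂ _ _))
        (channelProb_nonneg hW _ _ _ _), le_rfl]

theorem ChannelCode.errorProb_nonneg (hW : ∀ x₁ x₂, W x₁ x₂ ∈ stdSimplex ℝ (Y₁ × Y₂))
    {n M₁ M₂ : ℕ} (c : ChannelCode X₁ X₂ Y₁ Y₂ n M₁ M₂) : 0 ≤ c.errorProb W :=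
  mul_nonneg (by positivity) (Finset.sum_nonneg fun w₁ _ => Finset.sum_nonneg fun w₂ _ =>
    c.messageErrorProb_nonneg hW w₁ w₂)

/-- If both source codes succeed, only a channel error at the actual pair of indices can spoil the
result. That pair need not be uniform, so `ChannelCode.errorProb` cannot stand here. -/
theorem JointCode.ofSeparate_errorProb_le (hp₁ : p₁ ∈ stdSimplex ℝ (U₁ × V₁))
    (hp₂ : p₂ ∈ stdSimplex ℝ (U₂ × V₂)) (hW : ∀ x₁ x₂, W x₁ x₂ ∈ stdSimplex ℝ (Y₁ × Y₂))
    {n M₁ M₂ : ℕ} (s₁ : SlepianWolfCode U₁ V₁ n M₁) (s₂ : SlepianWolfCode U₂ V₂ n M₂)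
    (c : ChannelCode X₁ X₂ Y₁ Y₂ n M₁ M₂) :
    (JointCode.ofSeparate s₁ s₂ c).errorProb p₁ p₂ W ≤ s₁.errorProb p₁ + s₂.errorProb p₂ +
      ∑ u₁, ∑ v₁, ∑ u₂, ∑ v₂, sourceProb p₁ u₁ v₁ * sourceProb p₂ u₂ v₂ *
        c.messageErrorProb W (s₁.enc u₁) (s₂.enc u₂) := by
  classical
  have h₁ : s₁.errorProb p₁ = ∑ u₁, ∑ v₁, ∑ u₂ : Fin n → U₂, ∑ v₂ : Fin n → V₂,
      (if s₁.dec (s₁.enc u₁) v₁ ≠ u₁ then sourceProb p₁ u₁ v₁ else 0) *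
        sourceProb p₂ u₂ v₂ := by
    simp only [← Finset.mul_sum, sum_sourceProb hp₂ n, mul_one]
    rw [SlepianWolfCode.errorProb]
  have h₂ : s₂.errorProb p₂ = ∑ u₁ : Fin n → U₁, ∑ v₁ : Fin n → V₁, ∑ u₂, ∑ v₂,
      sourceProb p₁ u₁ v₁ * if s₂.dec (s₂.enc u₂) v₂ ≠ u₂ then sourceProb p₂ u₂ v₂ else 0 := by
    simp only [← Finset.mul_sum, ← Finset.sum_mul, sum_sourceProb hp₁ n, one_mul]
    rw [SlepianWolfCode.errorProb]
  rw [h₁, h₂]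
  simp only [← Finset.sum_add_distrib]
  refine Finset.sum_le_sum fun u₁ _ => Finset.sum_le_sum fun v₁ _ => Finset.sum_le_sum fun u₂ _ =>
    Finset.sum_le_sum fun v₂ _ => ?_
  set a := sourceProb p₁ u₁ v₁ with ha
  set b := sourceProb p₂ u₂ v₂ with hb
  have ha0 : 0 ≤ a := sourceProb_nonneg hp₁ _ _
  have hb0 : 0 ≤ b := sourceProb_nonneg hp₂ _ _
  have hab := mul_nonneg ha0 hb0
  have hK := sum_channelProb hW (c.enc₁ (s₁.enc u₁)) (c.enc₂ (s₂.enc u₂))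
  have hK0 := channelProb_nonneg hW (c.enc₁ (s₁.enc u₁)) (c.enc₂ (s₂.enc u₂))
  have hm := mul_nonneg hab (c.messageErrorProb_nonneg hW (s₁.enc u₁) (s₂.enc u₂))
  have hle : (∑ y₁, ∑ y₂, if ((JointCode.ofSeparate s₁ s₂ c).dec₁ y₁ v₁,
      (JointCode.ofSeparate s₁ s₂ c).dec₂ y₂ v₂) ≠ (u₁, u₂) then
      a * b * channelProb W (c.enc₁ (s₁.enc u₁)) (c.enc₂ (s₂.enc u₂)) y₁ y₂ else 0) ≤ a * b := by
    refine (Finset.sum_le_sum fun y₁ _ => Finset.sum_le_sum fun y₂ _ => ?_).trans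
      (show ∑ y₁, ∑ y₂, a * b *
        channelProb W (c.enc₁ (s₁.enc u₁)) (c.enc₂ (s₂.enc u₂)) y₁ y₂ ≤ a * b from ?_)
    · split_ifs
      exacts [le_rfl, mul_nonneg hab (hK0 _ _)]
    · simp only [← Finset.mul_sum, hK, mul_one, le_refl]
  by_cases g₁ : s₁.dec (s₁.enc u₁) v₁ = u₁
  · by_cases g₂ : s₂.dec (s₂.enc u₂) v₂ = u₂
    · simp only [g₁, g₂, ne_eq, not_true_eq_false, if_false, zero_mul, mul_zero, zero_add]
      rw [ChannelCode.messageErrorProb, Finset.mul_sum]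
      refine Finset.sum_le_sum fun y₁ _ => ?_
      rw [Finset.mul_sum]
      refine Finset.sum_le_sum fun y₂ _ => ?_
      by_cases g : (c.dec₁ y₁, c.dec₂ y₂) = (s₁.enc u₁, s₂.enc u₂)
      · have hd₁ : c.dec₁ y₁ = s₁.enc u₁ := congrArg Prod.fst g
        have hd₂ : c.dec₂ y₂ = s₂.enc u₂ := congrArg Prod.snd g
        simp [JointCode.ofSeparate, hd₁, hd₂, g₁, g₂]
      · rw [if_pos g]
        split_ifs
        exacts [mul_nonneg hab (hK0 _ _), le_rfl]
    · refine hle.trans ?_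
      simp only [g₁, g₂, ne_eq, not_true_eq_false, not_false_eq_true, if_true, if_false]
      linarith
  · refine hle.trans ?_
    rw [if_pos g₁]
    have : 0 ≤ a * if s₂.dec (s₂.enc u₂) v₂ ≠ u₂ then b else 0 :=
      mul_nonneg ha0 (by split_ifs <;> simp [hb0])
    linarith

open Classical in
theorem ChannelCode.exists_slepianWolfCodes (hp₁ : p₁ ∈ stdSimplex ℝ (U₁ × V₁))
    (hp₂ : p₂ ∈ stdSimplex ℝ (U₂ × V₂)) (hW : ∀ x₁ x₂, W x₁ x₂ ∈ stdSimplex ℝ (Y₁ × Y₂))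
    {n M₁ M₂ : ℕ} [NeZero M₁] [NeZero M₂] (c : ChannelCode X₁ X₂ Y₁ Y₂ n M₁ M₂) {θ₁ θ₂ : ℝ}
    (hθ₁ : 0 < θ₁) (hθ₂ : 0 < θ₂) {ε : ℝ}
    (hε : ε = ((∑ u : Fin n → U₁, ∑ v : Fin n → V₁,
        if sourceProb p₁ u v < θ₁ * sideProb p₁ v then sourceProb p₁ u v else 0) +
          1 / (θ₁ * M₁)) +
      ((∑ u : Fin n → U₂, ∑ v : Fin n → V₂,
        if sourceProb p₂ u v < θ₂ * sideProb p₂ v then sourceProb p₂ u v else 0) +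
          1 / (θ₂ * M₂)) + c.errorProb W) :
    ∃ (s₁ : SlepianWolfCode U₁ V₁ n M₁) (s₂ : SlepianWolfCode U₂ V₂ n M₂),
      s₁.errorProb p₁ ≤ ε ∧ s₂.errorProb p₂ ≤ ε ∧
        (JointCode.ofSeparate s₁ s₂ c).errorProb p₁ p₂ W ≤ ε := by
  have : Nonempty U₁ := by
    by_contra hU
    rw [not_nonempty_iff] at hU
    simpa using hp₁.2
  have : Nonempty U₂ := by
    by_contra hU
    rw [not_nonempty_iff] at hU
    simpa using hp₂.2
  have hM₁ : (0 : ℝ) < M₁ := Nat.cast_pos.2 (NeZero.pos M₁)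
  have hM₂ : (0 : ℝ) < M₂ := Nat.cast_pos.2 (NeZero.pos M₂)
  have hP₁ : ∑ _ : Fin M₁, (M₁ : ℝ)⁻¹ = 1 := by simp [hM₁.ne']
  have hP₂ : ∑ _ : Fin M₂, (M₂ : ℝ)⁻¹ = 1 := by simp [hM₂.ne']
  have hP₁0 : ∀ _ : Fin M₁, (0 : ℝ) ≤ (M₁ : ℝ)⁻¹ := fun _ => inv_nonneg.2 hM₁.le
  have hP₂0 : ∀ _ : Fin M₂, (0 : ℝ) ≤ (M₂ : ℝ)⁻¹ := fun _ => inv_nonneg.2 hM₂.le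
  let S₁ : ((Fin n → U₁) → Fin M₁) → SlepianWolfCode U₁ V₁ n M₁ := fun s =>
    ⟨s, binDec (fun u v => sourceProb p₁ u v) (fun _ v => θ₁ * ∑ u', sourceProb p₁ u' v) s⟩
  let S₂ : ((Fin n → U₂) → Fin M₂) → SlepianWolfCode U₂ V₂ n M₂ := fun s =>
    ⟨s, binDec (fun u v => sourceProb p₂ u v) (fun _ v => θ₂ * ∑ u', sourceProb p₂ u' v) s⟩
  have b₁ : randAvg (fun _ : Fin M₁ => (M₁ : ℝ)⁻¹) (fun s => (S₁ s).errorProb p₁) ≤ _ :=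
    randAvg_binDec_error_le (fun u v => sourceProb_nonneg hp₁ u v) (sum_sourceProb hp₁ n) hθ₁
  have b₂ : randAvg (fun _ : Fin M₂ => (M₂ : ℝ)⁻¹) (fun s => (S₂ s).errorProb p₂) ≤ _ :=
    randAvg_binDec_error_le (fun u v => sourceProb_nonneg hp₂ u v) (sum_sourceProb hp₂ n) hθ₂
  simp only [sum_sourceProb_eq_sideProb] at b₁ b₂
  obtain ⟨t₁, t₂, ht⟩ := exists_le_randAvg_randAvg hP₁0 hP₁ hP₂0 hP₂
    (fun (t₁ : (Fin n → U₁) → Fin M₁) (t₂ : (Fin n → U₂) → Fin M₂) =>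
      (S₁ t₁).errorProb p₁ + (S₂ t₂).errorProb p₂ + ∑ u₁, ∑ v₁, ∑ u₂, ∑ v₂,
        sourceProb p₁ u₁ v₁ * sourceProb p₂ u₂ v₂ * c.messageErrorProb W (t₁ u₁) (t₂ u₂))
  -- For fixed blocks the random bin indices are independent and uniform, like the messages in
  -- `ChannelCode.errorProb`.
  have hmsg : ∀ (u₁ : Fin n → U₁) (u₂ : Fin n → U₂),
      (randAvg (fun _ => (M₁ : ℝ)⁻¹) fun t₁ : (Fin n → U₁) → Fin M₁ =>
        randAvg (fun _ => (M₂ : ℝ)⁻¹) fun t₂ : (Fin n → U₂) → Fin M₂ =>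
          c.messageErrorProb W (t₁ u₁) (t₂ u₂)) = c.errorProb W := by
    intro u₁ u₂
    have e₂ : ∀ t₁ : (Fin n → U₁) → Fin M₁,
        (randAvg (fun _ => (M₂ : ℝ)⁻¹) fun t₂ : (Fin n → U₂) → Fin M₂ =>
          c.messageErrorProb W (t₁ u₁) (t₂ u₂)) =
        ∑ w₂, (M₂ : ℝ)⁻¹ * c.messageErrorProb W (t₁ u₁) w₂ := fun t₁ =>
      randAvg_apply hP₂ u₂ fun w₂ => c.messageErrorProb W (t₁ u₁) w₂
    simp only [e₂]
    rw [randAvg_apply hP₁ u₁ fun w₁ => ∑ w₂, (M₂ : ℝ)⁻¹ * c.messageErrorProb W w₁ w₂]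
    simp only [← Finset.mul_sum]
    rw [ChannelCode.errorProb, mul_inv, mul_assoc]
    rfl
  simp only [randAvg_add, randAvg_const hP₁, randAvg_const hP₂, randAvg_sum, randAvg_const_mul,
    hmsg] at ht
  have havg : ∑ u₁ : Fin n → U₁, ∑ v₁ : Fin n → V₁, ∑ u₂ : Fin n → U₂, ∑ v₂ : Fin n → V₂,
      sourceProb p₁ u₁ v₁ * sourceProb p₂ u₂ v₂ * c.errorProb W = c.errorProb W := by
    simp only [← Finset.sum_mul, ← Finset.mul_sum, sum_sourceProb hp₁ n, sum_sourceProb hp₂ n,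
      mul_one, one_mul]
  rw [havg] at ht
  have hj := JointCode.ofSeparate_errorProb_le hp₁ hp₂ hW (S₁ t₁) (S₂ t₂) c
  have n₁ := (S₁ t₁).errorProb_nonneg hp₁
  have n₂ := (S₂ t₂).errorProb_nonneg hp₂
  have n₃ : 0 ≤ ∑ u₁, ∑ v₁, ∑ u₂, ∑ v₂,
      sourceProb p₁ u₁ v₁ * sourceProb p₂ u₂ v₂ * c.messageErrorProb W (t₁ u₁) (t₂ u₂) :=
    Finset.sum_nonneg fun _ _ => Finset.sum_nonneg fun _ _ => Finset.sum_nonneg fun _ _ =>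
      Finset.sum_nonneg fun _ _ => mul_nonneg (mul_nonneg (sourceProb_nonneg hp₁ _ _)
        (sourceProb_nonneg hp₂ _ _)) (c.messageErrorProb_nonneg hW _ _)
  -- The binnings make the sum of three nonnegative terms at most `ε`, hence each term as well.
  refine ⟨S₁ t₁, S₂ t₂, ?_, ?_, ?_⟩
  · linarith
  · linarith
  · refine hj.trans ?_
    change _ + _ + ∑ u₁, ∑ v₁, ∑ u₂, ∑ v₂,
      sourceProb p₁ u₁ v₁ * sourceProb p₂ u₂ v₂ * c.messageErrorProb W (t₁ u₁) (t₂ u₂) ≤ _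
    linarith

/-! ### Asymptotics -/

instance numMessages_neZero (n : ℕ) (R : ℝ) : NeZero (numMessages n R) :=
  ⟨(Nat.ceil_pos.2 (Real.rpow_pos_of_pos two_pos _)).ne'⟩

theorem rpow_le_numMessages (n : ℕ) (R : ℝ) : (2 : ℝ) ^ (n * R) ≤ numMessages n R :=
  Nat.le_ceil _

/-- For `R ≤ 0` there is exactly one message, so the left side is 0; otherwise the 1 absorbs the
ceiling. -/
theorem numMessages_sub_one_le (n : ℕ) (R : ℝ) :
    (numMessages n (max R 0) : ℝ) - 1 ≤ (2 : ℝ) ^ (n * R) := by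
  rcases le_total R 0 with h | h
  · simp [numMessages, max_eq_right h, Real.rpow_nonneg]
  · rw [max_eq_left h, sub_le_iff_le_add]
    exact (Nat.ceil_lt_add_one (Real.rpow_nonneg two_pos.le _)).le

theorem tendsto_two_rpow_neg_mul {a : ℝ} (ha : 0 < a) :
    Tendsto (fun n : ℕ => (2 : ℝ) ^ (-(n * a))) atTop (𝓝 0) := by
  have h : ∀ n : ℕ, (2 : ℝ) ^ (-(n * a)) = ((2 : ℝ) ^ (-a)) ^ n := fun n => by
    rw [← Real.rpow_natCast, ← Real.rpow_mul two_pos.le]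
    congr 1
    ring
  simp only [h]
  exact tendsto_pow_atTop_nhds_zero_of_lt_one (Real.rpow_nonneg two_pos.le _)
    (Real.rpow_lt_one_of_one_lt_of_neg one_lt_two (neg_lt_zero.2 ha))

/-! ### The converse and the direct part in the limit. -/

theorem achievable_of_reliablyTransmittable (hp₁ : p₁ ∈ stdSimplex ℝ (U₁ × V₁))
    (hp₂ : p₂ ∈ stdSimplex ℝ (U₂ × V₂)) (hW : ∀ x₁ x₂, W x₁ x₂ ∈ stdSimplex ℝ (Y₁ × Y₂))
    (h : ReliablyTransmittable p₁ p₂ W) {ε : ℝ} (hε : 0 < ε) :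
    Achievable W (max (condEntropy p₁ - 3 * ε) 0, max (condEntropy p₂ - 3 * ε) 0) := by
  classical
  obtain ⟨c, hc⟩ := h
  refine ⟨le_max_right _ _, le_max_right _ _, ?_⟩
  have hpos : ∀ x : ℝ, (0 : ℝ) < 2 ^ x := fun x => Real.rpow_pos_of_pos two_pos x
  -- With `τ = 2^(-n(H-ε))`, `γ = 2^(n(H-2ε))` and rate `H-3ε`, both `τ γ` and `(M-1)/γ` are at most
  -- `2^(-nε)`.
  choose d hd using fun n : ℕ => (c n).exists_channelCode hp₁ hp₂ hW
    (numMessages n (max (condEntropy p₁ - 3 * ε) 0))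
    (numMessages n (max (condEntropy p₂ - 3 * ε) 0))
    (hpos (-(n * (condEntropy p₁ - ε)))).le (hpos (n * (condEntropy p₁ - 2 * ε)))
    (hpos (-(n * (condEntropy p₂ - ε)))).le (hpos (n * (condEntropy p₂ - 2 * ε)))
  have hprod : ∀ (n : ℕ) (H : ℝ),
      (2 : ℝ) ^ (-(n * (H - ε))) * 2 ^ (n * (H - 2 * ε)) = 2 ^ (-(n * ε)) := fun n H => by
    rw [← Real.rpow_add two_pos]
    congr 1
    ring
  have hquot : ∀ (n : ℕ) (H : ℝ),
      ((numMessages n (max (H - 3 * ε) 0) : ℝ) - 1) / 2 ^ (n * (H - 2 * ε)) ≤ 2 ^ (-(n * ε)) :=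
    fun n H => by
      rw [div_le_iff₀ (hpos _), ← Real.rpow_add two_pos]
      refine (numMessages_sub_one_le n _).trans (le_of_eq ?_)
      congr 1
      ring
  have hs := tendsto_two_rpow_neg_mul hε
  have h₁ := tendsto_prob_condProb_gt hp₁ (sub_lt_self (condEntropy p₁) hε)
  have h₂ := tendsto_prob_condProb_gt hp₂ (sub_lt_self (condEntropy p₂) hε)
  have hlim := (((hc.add h₁).add hs).add hs).add (((hc.add h₂).add hs).add hs)
  simp only [add_zero] at hlim
  refine ⟨d, squeeze_zero (fun n => (d n).errorProb_nonneg hW) (fun n => (hd n).trans ?_) hlim⟩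
  rw [hprod, hprod]
  exact add_le_add (add_le_add le_rfl (hquot n _)) (add_le_add le_rfl (hquot n _))

theorem mem_capacityRegion_of_reliablyTransmittable (hp₁ : p₁ ∈ stdSimplex ℝ (U₁ × V₁))
    (hp₂ : p₂ ∈ stdSimplex ℝ (U₂ × V₂)) (hW : ∀ x₁ x₂, W x₁ x₂ ∈ stdSimplex ℝ (Y₁ × Y₂))
    (h : ReliablyTransmittable p₁ p₂ W) :
    (condEntropy p₁, condEntropy p₂) ∈ capacityRegion W := by
  refine Metric.mem_closure_iff.2 fun ε hε =>
    ⟨_, achievable_of_reliablyTransmittable hp₁ hp₂ hW h (ε := ε / 6) (by positivity), ?_⟩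
  -- The rate loss is `ε/2`, and since `H ≥ 0`, clipping at 0 does not increase it.
  have hdist : ∀ H : ℝ, 0 ≤ H → dist H (max (H - 3 * (ε / 6)) 0) < ε := fun H hH => by
    rw [Real.dist_eq, abs_lt]
    rcases max_cases (H - 3 * (ε / 6)) 0 with h | h <;> constructor <;> linarith
  rw [Prod.dist_eq]
  exact max_lt (hdist _ (condEntropy_nonneg hp₁)) (hdist _ (condEntropy_nonneg hp₂))

/-- Shifting both coordinates up by `ε/2` stays in the region; an achievable pair within less than
`ε/2` of the shifted point, in the sup metric, still exceeds `R`. -/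
theorem exists_achievable_gt {R : ℝ × ℝ} (h : R ∈ interior (capacityRegion W)) :
    ∃ R', Achievable W R' ∧ R.1 < R'.1 ∧ R.2 < R'.2 := by
  obtain ⟨ε, hε, hball⟩ := Metric.mem_nhds_iff.1 (mem_interior_iff_mem_nhds.1 h)
  have hmem : (R.1 + ε / 2, R.2 + ε / 2) ∈ capacityRegion W := hball <| by
    rw [Metric.mem_ball, Prod.dist_eq, Real.dist_eq, Real.dist_eq]
    simp only [add_sub_cancel_left, max_self]
    rw [abs_of_pos (half_pos hε)]
    exact half_lt_self hε
  obtain ⟨R', hR', hd⟩ := Metric.mem_closure_iff.1 hmem (ε / 2) (half_pos hε)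
  rw [Prod.dist_eq, max_lt_iff, Real.dist_eq, Real.dist_eq, abs_lt, abs_lt] at hd
  exact ⟨R', hR', by linarith [hd.1.2], by linarith [hd.2.2]⟩

theorem separatelyTransmittable_of_achievable (hp₁ : p₁ ∈ stdSimplex ℝ (U₁ × V₁))
    (hp₂ : p₂ ∈ stdSimplex ℝ (U₂ × V₂)) (hW : ∀ x₁ x₂, W x₁ x₂ ∈ stdSimplex ℝ (Y₁ × Y₂))
    {R : ℝ × ℝ} (hR : Achievable W R) (h₁ : condEntropy p₁ < R.1) (h₂ : condEntropy p₂ < R.2) :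
    SeparatelyTransmittable p₁ p₂ W := by
  classical
  obtain ⟨hR₁, hR₂, c, hc⟩ := hR
  -- With `H < a < R` and `θ = 2^(-na)`, the gap `a - H` makes blocks less likely than `θ` rare, and
  -- the gap `R - a` makes the collision term at most `2^(-n(R-a))`.
  obtain ⟨a₁, ha₁, ha₁'⟩ := exists_between h₁
  obtain ⟨a₂, ha₂, ha₂'⟩ := exists_between h₂
  have hpos : ∀ x : ℝ, (0 : ℝ) < 2 ^ x := fun x => Real.rpow_pos_of_pos two_pos x
  choose s₁ s₂ e₁ e₂ e using fun n : ℕ => (c n).exists_slepianWolfCodes hp₁ hp₂ hW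
    (hpos (-(n * a₁))) (hpos (-(n * a₂))) rfl
  have hbin : ∀ (n : ℕ) (a R : ℝ),
      1 / ((2 : ℝ) ^ (-(n * a)) * numMessages n R) ≤ 2 ^ (-(n * (R - a))) := fun n a R => by
    have h : (2 : ℝ) ^ (n * (R - a)) ≤ 2 ^ (-(n * a)) * numMessages n R := by
      refine le_trans (le_of_eq ?_)
        (mul_le_mul_of_nonneg_left (rpow_le_numMessages n R) (hpos _).le)
      rw [← Real.rpow_add two_pos]
      congr 1
      ring
    rw [Real.rpow_neg two_pos.le (n * (R - a)), ← one_div]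
    exact one_div_le_one_div_of_le (hpos _) h
  have hbin_lim : ∀ {a R : ℝ}, a < R → Tendsto
      (fun n : ℕ => 1 / ((2 : ℝ) ^ (-(n * a)) * numMessages n R)) atTop (𝓝 0) := fun h =>
    squeeze_zero (fun n => by positivity) (fun n => hbin n _ _)
      (tendsto_two_rpow_neg_mul (sub_pos.2 h))
  have hlim := (((tendsto_prob_condProb_lt hp₁ ha₁).add (hbin_lim ha₁')).add
    ((tendsto_prob_condProb_lt hp₂ ha₂).add (hbin_lim ha₂'))).add hc
  simp only [add_zero] at hlim
  exact ⟨R.1, R.2, hR₁, hR₂, s₁, s₂, c,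
    squeeze_zero (fun n => (s₁ n).errorProb_nonneg hp₁) e₁ hlim,
    squeeze_zero (fun n => (s₂ n).errorProb_nonneg hp₂) e₂ hlim, hc,
    squeeze_zero (fun n => JointCode.errorProb_nonneg hp₁ hp₂ hW _) e hlim⟩

theorem SeparatelyTransmittable.reliablyTransmittable (h : SeparatelyTransmittable p₁ p₂ W) :
    ReliablyTransmittable p₁ p₂ W := by
  obtain ⟨_, _, _, _, s₁, s₂, c, _, _, _, hlim⟩ := h
  exact ⟨fun n => JointCode.ofSeparate (s₁ n) (s₂ n) (c n), hlim⟩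

end Coding

end InterferenceChannel

theorem theorem1 {U₁ V₁ U₂ V₂ X₁ X₂ Y₁ Y₂ : Type*}
    [Fintype U₁] [Fintype V₁] [Fintype U₂] [Fintype V₂]
    [Fintype X₁] [Fintype X₂] [Fintype Y₁] [Fintype Y₂]
    (p₁ : U₁ × V₁ → ℝ) (hp₁ : p₁ ∈ stdSimplex ℝ (U₁ × V₁))
    (p₂ : U₂ × V₂ → ℝ) (hp₂ : p₂ ∈ stdSimplex ℝ (U₂ × V₂))
    (W : X₁ → X₂ → Y₁ × Y₂ → ℝ) (hW : ∀ x₁ x₂, W x₁ x₂ ∈ stdSimplex ℝ (Y₁ × Y₂)) :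
    ((InterferenceChannel.condEntropy p₁, InterferenceChannel.condEntropy p₂) ∈
        interior (InterferenceChannel.capacityRegion W) →
      InterferenceChannel.ReliablyTransmittable p₁ p₂ W ∧
        InterferenceChannel.SeparatelyTransmittable p₁ p₂ W) ∧
    ((InterferenceChannel.condEntropy p₁, InterferenceChannel.condEntropy p₂) ∉
        InterferenceChannel.capacityRegion W →
      ¬ InterferenceChannel.ReliablyTransmittable p₁ p₂ W) := by
  refine ⟨fun h => ?_, fun h hr => h
    (InterferenceChannel.mem_capacityRegion_of_reliablyTransmittable hp₁ hp₂ hW hr)⟩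
  obtain ⟨R, hR, h₁, h₂⟩ := InterferenceChannel.exists_achievable_gt h
  have hs := InterferenceChannel.separatelyTransmittable_of_achievable hp₁ hp₂ hW hR h₁ h₂
  exact ⟨hs.reliablyTransmittable, hs⟩
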